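/- **Setting.** All manifolds are smooth, Hausdorff and finite dimensional. Let $\mathcal G \rightrightarrows M$ be a Lie groupoid with source $s$, target $t$, unit $1$, multiplication $m:\mathcal G^{(2)}\to\mathcal G$ ($gh$ is defined iff $s(g)=t(h)$), projections $\mathrm{pr}_1,\mathrm{pr}_2:\mathcal G^{(2)}\to\mathcal G$, and Lie algebroid $A$, $A_x=\ker (ds)_{1_x}$. Let $\mathcal G$ act smoothly and linearly on a real line bundle $L\to M$ (the action of $g$ is an isomorphism $L_{s(g)}\to L_{t(g)}$, $\ell\mapsto g.\ell$), and let $L_{\mathcal G}=t^*L$, with the LB-groupoid structure $(t^*L\rightrightarrows 0_M;\mathcal G\rightrightarrows M)$ with multiplication $(g,\ell)\cdot(h,\ell')=(gh,\ell+g.\ell')$. **Derivations, jets, Atiyah tensors.** For a line bundle $L\to M$, $D_xL$ is the space of $\mathbb R$-linear maps $\Delta:\Gamma(L)\to L_x$ such that, for some $v\in T_xM$, $\Delta(f\lambda)=v(f)\lambda_x+f(x)\Delta\lambda$ for all $f\in C^\infty(M)$, $\lambda\in\Gamma(L)$; and $\mathfrak J^1L=\mathrm{Hom}(DL,L)$.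 A line bundle map $\varphi:L_N\to L$ which is an isomorphism on fibers induces $D\varphi:DL_N\to DL$, $D\varphi(\Delta)\lambda=\varphi(\Delta(\varphi^*\lambda))$. An Atiyah $(l,m)$-tensor on $L$ is a smooth section $T$ of $(DL)^{*\otimes l}\otimes(\mathfrak J^1L)^{*\otimes m}\otimes L$. **Groupoids $DL_{\mathcal G}\rightrightarrows DL$ and $\mathfrak J^1L_{\mathcal G}\rightrightarrows A^*\otimes L$.** Identify the line bundle $m^*L_{\mathcal G}$ over $\mathcal G^{(2)}$, whose fiber over $(g,h)$ is $L_{t(g)}$, with $\mathrm{pr}_1^*L_{\mathcal G}$ by the identity and with $\mathrm{pr}_2^*L_{\mathcal G}$ by $\ell\mapsto g^{-1}.\ell$. The source and target of $DL_{\mathcal G}$ are induced by the line bundle maps $L_{\mathcal G}\to L$, $(g,\ell)\mapsto g^{-1}.\ell$ and $(g,\ell)\mapsto\ell$; the composable pairs are the pairs $(D\mathrm{pr}_1(\square),D\mathrm{pr}_2(\square))$ with $\square\in D(m^*L_{\mathcal G})$, with product $Dm(\square)$; the unit and the inversion $i_D$ are induced by $L\to L_{\mathcal G}$, $\ell\mapsto(1,\ell)$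 and by $L_{\mathcal G}\to L_{\mathcal G}$, $(g,\ell)\mapsto(g^{-1},g^{-1}.\ell)$. For $a\in A_x$ let $\mathbb D_a\in D_{1_x}L_{\mathcal G}$ be the element of the kernel of the source map of $DL_{\mathcal G}$ with symbol $a$. For $\psi\in\mathfrak J^1L_{\mathcal G}$ over $g$, source and target are given by $$\langle s(\psi),a\rangle=-g^{-1}.\langle\psi,0_g\cdot i_D(\mathbb D_a)\rangle,\qquad \langle t(\psi),b\rangle=\langle\psi,\mathbb D_b\cdot 0_g\rangle\qquad(a\in A_{s(g)},\ b\in A_{t(g)}),$$ and, for $\psi_1,\psi_2$ composable over $(g,h)$, the product $\psi_1\cdot\psi_2$ is determined by $\langle\psi_1\cdot\psi_2,\Delta_1\cdot\Delta_2\rangle=\langle\psi_1,\Delta_1\rangle+g.\langle\psi_2,\Delta_2\rangle$ for all composable $\Delta_1,\Delta_2\in DL_{\mathcal G}$ over $(g,h)$. **Multiplicativity.** An Atiyah $(l,m)$-tensor $T$ on $L_{\mathcal G}$ is *multiplicative* if the map $$f_T:\underbrace{DL_{\mathcal G}\times_{\mathcal G}\cdots\times_{\mathcal G}DL_{\mathcal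 G}}_{l}\times_{\mathcal G}\underbrace{\mathfrak J^1L_{\mathcal G}\times_{\mathcal G}\cdots\times_{\mathcal G}\mathfrak J^1L_{\mathcal G}}_{m}\to L_{\mathcal G}$$ obtained by evaluating $T$ is a groupoid map, the left-hand side having the component-wise groupoid structure. An ordinary $(l,m)$-tensor $\mathcal T$ on a Lie groupoid $\mathcal H$ (a section of $(T^*\mathcal H)^{\otimes l}\otimes(T\mathcal H)^{\otimes m}$) is *multiplicative* if the function $f_{\mathcal T}$ on the groupoid $T\mathcal H\times_{\mathcal H}\cdots\times_{\mathcal H}T\mathcal H\times_{\mathcal H}T^*\mathcal H\times_{\mathcal H}\cdots\times_{\mathcal H}T^*\mathcal H$ ($l$ factors $T\mathcal H$, $m$ factors $T^*\mathcal H$, with the tangent and cotangent groupoid structures) satisfies $f_{\mathcal T}(\Theta_1\cdot\Theta_2)=f_{\mathcal T}(\Theta_1)+f_{\mathcal T}(\Theta_2)$ for all composable $\Theta_1,\Theta_2$. **Homogenization.** The homogenization of $L\to M$ is $\widetilde M=L^*\smallsetminus 0$, with fiberwise bijective maps $p_T:T\widetilde M\to DL$ and $p_{T^*}:T^*\widetilde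 M\to\mathfrak J^1L$ given by $\langle\epsilon,p_T(v)\lambda\rangle=v(\tilde\lambda)$, where $\tilde\lambda(\epsilon)=\langle\epsilon,\lambda\rangle$, and $\langle\epsilon,\langle p_{T^*}(\theta),p_T(v)\rangle\rangle=\langle\theta,v\rangle$, for $v\in T_\epsilon\widetilde M$, $\theta\in T^*_\epsilon\widetilde M$, $\lambda\in\Gamma(L)$. The homogenization of an Atiyah $(l,m)$-tensor $T$ on $L$ is the $(l,m)$-tensor $\widetilde T$ on $\widetilde M$ with $$\widetilde T_\epsilon(v_1,\dots,v_l;\theta_1,\dots,\theta_m)=\langle\epsilon,T(p_Tv_1,\dots,p_Tv_l;p_{T^*}\theta_1,\dots,p_{T^*}\theta_m)\rangle .$$ The homogenization $\widetilde{\mathcal G}$ of $L_{\mathcal G}\to\mathcal G$ is a Lie groupoid over $\widetilde M$, namely the dual of the VB-groupoid $L_{\mathcal G}$ with the zero section removed: an arrow is a pair $(g,\epsilon)$ with $g\in\mathcal G$ and $0\ne\epsilon\in L^*_{t(g)}$, with source $g^{-1}.\epsilon$, target $\epsilon$, and $(g,\epsilon)\cdot(h,\delta)=(gh,\epsilon)$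 whenever $\delta=g^{-1}.\epsilon$. **Proposition.** Let $l,m\ge 0$. An Atiyah $(l,m)$-tensor $T$ on $L_{\mathcal G}$ is multiplicative if and only if its homogenization $\widetilde T$ is a multiplicative tensor on the groupoid $\widetilde{\mathcal G}$. -/

import Mathlib

open Bundle Set
open scoped Manifold ContDiff Topology

noncomputable section

section LineBundles

variable {E : Type*} [NormedAddCommGroup E] [NormedSpace ℝ E]
  {H : Type*} [TopologicalSpace H]

/-- A smooth real line bundle over the manifold `M`. -/
structure LineBundle (I : ModelWithCorners ℝ E H) (M : Type*) [TopologicalSpace M]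
    [ChartedSpace H M] where
  /-- the fiber over a point -/
  Fib : M → Type*
  [addCommGroup : ∀ x, AddCommGroup (Fib x)]
  [module : ∀ x, Module ℝ (Fib x)]
  [topologicalSpace : ∀ x, TopologicalSpace (Fib x)]
  [isTopologicalAddGroup : ∀ x, IsTopologicalAddGroup (Fib x)]
  [continuousSMul : ∀ x, ContinuousSMul ℝ (Fib x)]
  [topologicalSpaceTotal : TopologicalSpace (TotalSpace ℝ Fib)]
  [fiberBundle : FiberBundle ℝ Fib]
  [vectorBundle : VectorBundle ℝ ℝ Fib]
  [contMDiffVectorBundle : ContMDiffVectorBundle ∞ ℝ Fib I]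

attribute [instance] LineBundle.addCommGroup LineBundle.module LineBundle.topologicalSpace
  LineBundle.isTopologicalAddGroup LineBundle.continuousSMul LineBundle.topologicalSpaceTotal
  LineBundle.fiberBundle LineBundle.vectorBundle LineBundle.contMDiffVectorBundle

namespace LineBundle

variable {I : ModelWithCorners ℝ E H} {M : Type*} [TopologicalSpace M] [ChartedSpace H M]
  {E' : Type*} [NormedAddCommGroup E'] [NormedSpace ℝ E']
  {H' : Type*} [TopologicalSpace H'] {I' : ModelWithCorners ℝ E' H'}
  {N : Type*} [TopologicalSpace N] [ChartedSpace H' N]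

/-- The smooth sections of `L`. -/
abbrev Sec (L : LineBundle I M) : Type _ := Cₛ^∞⟮I; ℝ, L.Fib⟯

/-- The total space of `L`. -/
abbrev Tot (L : LineBundle I M) : Type _ := TotalSpace ℝ L.Fib

/-- The pull-back line bundle. -/
def pullback (L : LineBundle I M) (f : C^∞⟮I', N; I, M⟯) : LineBundle I' N where
  Fib := f *ᵖ L.Fib
  addCommGroup x := inferInstanceAs (AddCommGroup (L.Fib (f x)))
  module x := inferInstanceAs (Module ℝ (L.Fib (f x)))
  topologicalSpace x := inferInstanceAs (TopologicalSpace (L.Fib (f x)))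
  isTopologicalAddGroup x := inferInstanceAs (IsTopologicalAddGroup (L.Fib (f x)))
  continuousSMul x := inferInstanceAs (ContinuousSMul ℝ (L.Fib (f x)))
  topologicalSpaceTotal := inferInstance
  fiberBundle := inferInstanceAs (FiberBundle ℝ ((f : N → M) *ᵖ L.Fib))
  vectorBundle := VectorBundle.pullback ℝ f
  contMDiffVectorBundle := ContMDiffVectorBundle.pullback ℝ L.Fib I' f

/-- The identity between the fibers over two equal points. -/
def castFib (L : LineBundle I M) {x y : M} (h : x = y) : L.Fib x ≃L[ℝ] L.Fib y :=
  h ▸ ContinuousLinearEquiv.refl ℝ (L.Fib x)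

theorem mk_castFib (L : LineBundle I M) {x y : M} (h : x = y) (v : L.Fib x) :
    (⟨y, L.castFib h v⟩ : L.Tot) = ⟨x, v⟩ := by
  subst h; rfl

/-- The product of a smooth function and a smooth section. -/
def fsmul (L : LineBundle I M) (f : C^∞⟮I, M; ℝ⟯) (lam : L.Sec) : L.Sec :=
  ⟨fun x => f x • lam x, f.contMDiff.smul_section lam.contMDiff⟩

/-- The fiber over `x` of the gauge algebroid `DL`: the `ℝ`-linear maps `Δ : Γ(L) → L_x` for which
there is a tangent vector `v` at `x` (the symbol of `Δ`) with `Δ(fλ) = v(f) λ_x + f(x) Δλ`. -/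
def D (L : LineBundle I M) (x : M) : Submodule ℝ (L.Sec →ₗ[ℝ] L.Fib x) where
  carrier := {Δ | ∃ v : TangentSpace I x, ∀ (f : C^∞⟮I, M; ℝ⟯) (lam : L.Sec),
    Δ (L.fsmul f lam) = mvfderiv I f x v • lam x + f x • Δ lam}
  add_mem' := by
    rintro Δ Δ' ⟨v, hv⟩ ⟨v', hv'⟩
    refine ⟨v + v', fun f lam => ?_⟩
    rw [LinearMap.add_apply, LinearMap.add_apply, hv, hv', map_add]
    module
  zero_mem' := ⟨0, fun f lam => by simp⟩
  smul_mem' := by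
    rintro c Δ ⟨v, hv⟩
    refine ⟨c • v, fun f lam => ?_⟩
    rw [LinearMap.smul_apply, LinearMap.smul_apply, hv, map_smul, smul_eq_mul]
    module

/-- The fiber over `x` of the first jet bundle `J¹L = Hom(DL, L)`. -/
abbrev J (L : LineBundle I M) (x : M) : Type _ := L.D x →ₗ[ℝ] L.Fib x

/-- A family of pointwise derivations is smooth if it maps smooth sections to smooth sections;
such families are the sections of `DL`, i.e. the derivations `Γ(L) → Γ(L)`. -/
def IsSmoothD (L : LineBundle I M) (Δ : ∀ x, L.D x) : Prop :=
  ∀ lam : L.Sec, ContMDiff I (I.prod 𝓘(ℝ, ℝ)) ∞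
    (fun x => (⟨x, (Δ x : L.Sec →ₗ[ℝ] L.Fib x) lam⟩ : L.Tot))

/-- Smooth sections of `J¹L = Hom(DL, L)`. -/
def IsSmoothJ (L : LineBundle I M) (ψ : ∀ x, L.J x) : Prop :=
  ∀ Δ : ∀ x, L.D x, L.IsSmoothD Δ → ContMDiff I (I.prod 𝓘(ℝ, ℝ)) ∞
    (fun x => (⟨x, ψ x (Δ x)⟩ : L.Tot))

/-- The fiber over `x` of `(DL)^{*⊗l} ⊗ (J¹L)^{*⊗m} ⊗ L`, seen as the space of multilinear maps
`(D_xL)^l × (J¹_xL)^m → L_x`. -/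
abbrev AtiyahFib (L : LineBundle I M) (l m : ℕ) (x : M) : Type _ :=
  MultilinearMap ℝ (fun _ : Fin l => L.D x) (MultilinearMap ℝ (fun _ : Fin m => L.J x) (L.Fib x))

/-- Atiyah `(l, m)`-tensors on `L`. -/
structure AtiyahTensor (L : LineBundle I M) (l m : ℕ) where
  /-- the value of the tensor at a point -/
  toFun : ∀ x, L.AtiyahFib l m x
  smooth : ∀ (Δ : Fin l → ∀ x, L.D x) (ψ : Fin m → ∀ x, L.J x),
    (∀ i, L.IsSmoothD (Δ i)) → (∀ j, L.IsSmoothJ (ψ j)) →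
    ContMDiff I (I.prod 𝓘(ℝ, ℝ)) ∞
      (fun x => (⟨x, toFun x (fun i => Δ i x) (fun j => ψ j x)⟩ : L.Tot))

/-- The fiber over `x` of the dual line bundle `L*`. -/
abbrev DualFib (L : LineBundle I M) (x : M) : Type _ := L.Fib x →L[ℝ] Trivial M ℝ x

/-- The total space of the dual line bundle `L*`. -/
abbrev Dual (L : LineBundle I M) : Type _ := TotalSpace (ℝ →L[ℝ] ℝ) L.DualFib

theorem isOpen_slit (L : LineBundle I M) : IsOpen {ε : L.Dual | ε.2 ≠ 0} := by
  rw [isOpen_iff_mem_nhds]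
  intro ε hε
  set e := trivializationAt (ℝ →L[ℝ] ℝ) L.DualFib ε.proj with he
  have hs : ε ∈ e.source := FiberBundle.mem_trivializationAt_proj_source
  have hz : ∀ δ ∈ e.source, (e δ).2 = 0 ↔ δ.2 = 0 := by
    intro δ hδ
    have hb : δ.proj ∈ e.baseSet := e.mem_source.1 hδ
    have := (e.continuousLinearEquivAt ℝ δ.proj hb).map_eq_zero_iff (x := δ.2)
    rwa [Bundle.Trivialization.continuousLinearEquivAt_apply] at this
  have hc : ContinuousAt (fun δ => (e δ).2) ε :=
    continuous_snd.continuousAt.comp (e.continuousOn.continuousAt (e.open_source.mem_nhds hs))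
  have hne : (e ε).2 ≠ 0 := fun h => hε ((hz ε hs).1 h)
  filter_upwards [hc.eventually_ne hne, e.open_source.mem_nhds hs] with δ h1 h2 h3
  exact h1 ((hz δ h2).2 h3)

/-- The slit dual bundle, as an open subset of `L*`. -/
def slit (L : LineBundle I M) : TopologicalSpace.Opens L.Dual := ⟨{ε | ε.2 ≠ 0}, L.isOpen_slit⟩

/-- The homogenization `M̃ = L* ∖ 0` of `L`. -/
abbrev Hgz (L : LineBundle I M) : Type _ := L.slit

/-- The projection `M̃ → M`. -/
def hproj (L : LineBundle I M) (ε : L.Hgz) : M := ε.1.proj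

/-- The point `ε` of `M̃`, seen as a linear form on the fiber of `L`. -/
def form (L : LineBundle I M) (ε : L.Hgz) : L.Fib (L.hproj ε) →L[ℝ] ℝ := ε.1.2

/-- The homogenization of a section of `L`: a function on `M̃`. -/
def hsec (L : LineBundle I M) (lam : L.Sec) (ε : L.Hgz) : ℝ := L.form ε (lam (L.hproj ε))

theorem contMDiff_hproj (L : LineBundle I M) :
    ContMDiff (I.prod 𝓘(ℝ, ℝ →L[ℝ] ℝ)) I ∞ L.hproj :=
  (contMDiff_proj L.DualFib).comp contMDiff_subtype_val

theorem contMDiff_hsec (L : LineBundle I M) (lam : L.Sec) :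
    ContMDiff (I.prod 𝓘(ℝ, ℝ →L[ℝ] ℝ)) 𝓘(ℝ, ℝ) ∞ (L.hsec lam) := by
  have h := ContMDiff.clm_bundle_apply (E₁ := L.Fib) (E₂ := Trivial M ℝ) (F₁ := ℝ) (F₂ := ℝ)
    (IB := I) (n := ∞) (IM := I.prod 𝓘(ℝ, ℝ →L[ℝ] ℝ)) (b := L.hproj)
    (ϕ := fun ε => ε.1.2) (v := fun ε => lam (L.hproj ε))
    (contMDiff_subtype_val) (lam.contMDiff.comp L.contMDiff_hproj)
  intro ε
  exact ((contMDiffAt_totalSpace).1 (h ε)).2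

theorem bijective_form (L : LineBundle I M) (ε : L.Hgz) : Function.Bijective (L.form ε) := by
  have hε : L.form ε ≠ 0 := ε.2
  set e := (trivializationAt ℝ L.Fib (L.hproj ε)).continuousLinearEquivAt ℝ (L.hproj ε)
    (FiberBundle.mem_baseSet_trivializationAt' _)
  have hsymm : ∀ v, v = e v • e.symm 1 := fun v => by
    rw [← map_smul, smul_eq_mul, mul_one, e.symm_apply_apply]
  have hne : L.form ε (e.symm 1) ≠ 0 := by
    intro h
    apply hε
    ext v
    rw [hsymm v, map_smul, h]; simp
  constructor
  · rw [injective_iff_map_eq_zero]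
    intro v hv
    rw [hsymm v, map_smul, smul_eq_mul] at hv
    have := (mul_eq_zero.1 hv).resolve_right hne
    rw [hsymm v, this, zero_smul]
  · intro r
    refine ⟨(r / L.form ε (e.symm 1)) • e.symm 1, ?_⟩
    rw [map_smul, smul_eq_mul, div_mul_cancel₀ _ hne]

/-- The canonical line bundle map `p_L : ℝ_M̃ → L`, given by `⟨ε, p_L(ε, r)⟩ = r`. -/
def pL (L : LineBundle I M) (ε : L.Hgz) : ℝ ≃ₗ[ℝ] L.Fib (L.hproj ε) :=
  (LinearEquiv.ofBijective (L.form ε : L.Fib (L.hproj ε) →ₗ[ℝ] ℝ) (L.bijective_form ε)).symm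

theorem form_pL (L : LineBundle I M) (ε : L.Hgz) (r : ℝ) : L.form ε (L.pL ε r) = r :=
  (LinearEquiv.ofBijective (L.form ε : L.Fib (L.hproj ε) →ₗ[ℝ] ℝ)
    (L.bijective_form ε)).apply_symm_apply r

theorem pL_form (L : LineBundle I M) (ε : L.Hgz) (v : L.Fib (L.hproj ε)) :
    L.pL ε (L.form ε v) = v :=
  (LinearEquiv.ofBijective (L.form ε : L.Fib (L.hproj ε) →ₗ[ℝ] ℝ)
    (L.bijective_form ε)).symm_apply_apply v

/-- The tangent space of the homogenization. -/
abbrev HT (L : LineBundle I M) (ε : L.Hgz) : Type _ :=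
  TangentSpace (I.prod 𝓘(ℝ, ℝ →L[ℝ] ℝ)) ε

theorem mdiff_hsec (L : LineBundle I M) (lam : L.Sec) (ε : L.Hgz) :
    MDifferentiableAt (I.prod 𝓘(ℝ, ℝ →L[ℝ] ℝ)) 𝓘(ℝ, ℝ) (L.hsec lam) ε :=
  (L.contMDiff_hsec lam).mdifferentiable (by simp) ε

/-- The vector bundle map `p_T : TM̃ → DL`, given by `⟨ε, p_T(v) λ⟩ = v(λ̃)`. -/
def pT (L : LineBundle I M) (ε : L.Hgz) : L.HT ε →ₗ[ℝ] L.D (L.hproj ε) where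
  toFun v := ⟨{
      toFun := fun lam => L.pL ε (mvfderiv (I.prod 𝓘(ℝ, ℝ →L[ℝ] ℝ)) (L.hsec lam) ε v)
      map_add' := by
        intro a b
        have h : L.hsec (a + b) = L.hsec a + L.hsec b := by
          funext δ; simp [hsec]
        rw [h, ← map_add, mvfderiv_add (L.mdiff_hsec a ε) (L.mdiff_hsec b ε)]
        rfl
      map_smul' := by
        intro c a
        have h : L.hsec (c • a) = (fun _ : L.Hgz => c) • L.hsec a := by
          funext δ; simp [hsec]
        rw [h, RingHom.id_apply, ← map_smul,
          mvfderiv_smul mdifferentiableAt_const (L.mdiff_hsec a ε), mvfderiv_const]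
        change L.pL ε (c • _ + (0 : ℝ) • L.hsec a ε) = _
        rw [zero_smul, add_zero]
        rfl }, by
    refine ⟨mfderiv (I.prod 𝓘(ℝ, ℝ →L[ℝ] ℝ)) I L.hproj ε v, fun f lam => ?_⟩
    have h : L.hsec (L.fsmul f lam) = (f ∘ L.hproj) • L.hsec lam := by
      funext δ; simp [hsec, fsmul]
    have hp : MDifferentiableAt (I.prod 𝓘(ℝ, ℝ →L[ℝ] ℝ)) I L.hproj ε :=
      L.contMDiff_hproj.mdifferentiable (by simp) ε
    have hf : MDifferentiableAt I 𝓘(ℝ, ℝ) f (L.hproj ε) :=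
      f.contMDiff.mdifferentiable (by simp) _
    have hl := L.pL_form ε (lam (L.hproj ε))
    simp only [LinearMap.coe_mk, AddHom.coe_mk]
    rw [h, mvfderiv_smul (hf.comp ε hp) (L.mdiff_hsec lam ε), mvfderiv_comp ε hf hp]
    change L.pL ε (f (L.hproj ε) • _ + mvfderiv I f (L.hproj ε) _ • L.form ε (lam (L.hproj ε))) = _
    rw [map_add, map_smul, map_smul, hl, add_comm]
    rfl⟩
  map_add' v w := by
    ext lam
    exact (congrArg (L.pL ε) (ContinuousLinearMap.map_add
      (mvfderiv (I.prod 𝓘(ℝ, ℝ →L[ℝ] ℝ)) (L.hsec lam) ε) v w)).trans (map_add (L.pL ε) _ _)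
  map_smul' c v := by
    ext lam
    exact (congrArg (L.pL ε) (ContinuousLinearMap.map_smul
      (mvfderiv (I.prod 𝓘(ℝ, ℝ →L[ℝ] ℝ)) (L.hsec lam) ε) c v)).trans
      (map_smul (L.pL ε) c _)

theorem pT_fsmul (L : LineBundle I M) (ε : L.Hgz) (w : L.HT ε) (f : C^∞⟮I, M; ℝ⟯) (lam : L.Sec) :
    (L.pT ε w : L.Sec →ₗ[ℝ] L.Fib (L.hproj ε)) (L.fsmul f lam) =
      mvfderiv I f (L.hproj ε) (mfderiv (I.prod 𝓘(ℝ, ℝ →L[ℝ] ℝ)) I L.hproj ε w) •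
        lam (L.hproj ε) + f (L.hproj ε) • (L.pT ε w : L.Sec →ₗ[ℝ] L.Fib (L.hproj ε)) lam := by
  have h : L.hsec (L.fsmul f lam) = (f ∘ L.hproj) • L.hsec lam := by
    funext δ; simp [hsec, fsmul]
  have hp : MDifferentiableAt (I.prod 𝓘(ℝ, ℝ →L[ℝ] ℝ)) I L.hproj ε :=
    L.contMDiff_hproj.mdifferentiable (by simp) ε
  have hf : MDifferentiableAt I 𝓘(ℝ, ℝ) f (L.hproj ε) :=
    f.contMDiff.mdifferentiable (by simp) _
  have hl := L.pL_form ε (lam (L.hproj ε))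
  change L.pL ε (mvfderiv (I.prod 𝓘(ℝ, ℝ →L[ℝ] ℝ)) (L.hsec (L.fsmul f lam)) ε w) = _
  rw [h, mvfderiv_smul (hf.comp ε hp) (L.mdiff_hsec lam ε), mvfderiv_comp ε hf hp]
  change L.pL ε (f (L.hproj ε) • _ + mvfderiv I f (L.hproj ε) _ • L.form ε (lam (L.hproj ε))) = _
  rw [map_add, map_smul, map_smul, hl, add_comm]
  rfl

/-- Derivations are determined by symbol and value on a local frame. -/
theorem D_formula (L : LineBundle I M) {x : M} {ψ f : C^∞⟮I, M; ℝ⟯} {s lam : L.Sec}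
    (hψ : ∀ᶠ y in 𝓝 x, ψ y = 1) (h : L.fsmul f s = L.fsmul ψ lam)
    (Δ : L.Sec →ₗ[ℝ] L.Fib x) (v : TangentSpace I x)
    (hv : ∀ (f : C^∞⟮I, M; ℝ⟯) (lam : L.Sec),
      Δ (L.fsmul f lam) = mvfderiv I f x v • lam x + f x • Δ lam) :
    Δ lam = mvfderiv I f x v • s x + f x • Δ s := by
  have h0 : mvfderiv I ψ x v = 0 := by
    have : (ψ : M → ℝ) =ᶠ[𝓝 x] fun _ => 1 := hψ
    have h1 : mfderiv I 𝓘(ℝ, ℝ) ψ x = mfderiv I 𝓘(ℝ, ℝ) (fun _ : M => (1 : ℝ)) x :=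
      this.mfderiv_eq
    rw [mfderiv_const] at h1
    change (mfderiv I 𝓘(ℝ, ℝ) ψ x v : ℝ) = 0
    exact congrArg (fun F => F v) h1
  have h1 := hv ψ lam
  rw [← h, hv f s, h0, hψ.self_of_nhds, zero_smul, zero_add, one_smul] at h1
  exact h1.symm

section

variable [IsManifold I ∞ M]

theorem hgz_eq_zero (L : LineBundle I M) (ε : L.Hgz) (w : L.HT ε) {s : L.Sec}
    (hs : ∀ᶠ y in 𝓝 (L.hproj ε), s y = (trivializationAt ℝ L.Fib (L.hproj ε)).symm y 1)
    (h1 : mfderiv (I.prod 𝓘(ℝ, ℝ →L[ℝ] ℝ)) I L.hproj ε w = 0)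
    (h2 : mvfderiv (I.prod 𝓘(ℝ, ℝ →L[ℝ] ℝ)) (L.hsec s) ε w = 0) : w = 0 := by
  set x := L.hproj ε
  set J := I.prod 𝓘(ℝ, ℝ →L[ℝ] ℝ)
  have hp : MDifferentiableAt J I L.hproj ε :=
    L.contMDiff_hproj.mdifferentiable (by simp) ε
  obtain ⟨A, hA⟩ := (isInvertible_mfderiv_extChartAt (I := J) (mem_extChartAt_source (I := J) ε))
  let F : L.Hgz → E × (ℝ →L[ℝ] ℝ) := fun δ =>
    (extChartAt I x (L.hproj δ), ContinuousLinearMap.toSpanSingleton ℝ (ContinuousLinearMap.id ℝ ℝ) (L.hsec s δ))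
  have hev : extChartAt J ε =ᶠ[𝓝 ε] F := by
    have hc := L.contMDiff_hproj.continuous.continuousAt (x := ε)
    filter_upwards [hc.eventually hs, hc.preimage_mem_nhds
      ((trivializationAt ℝ L.Fib x).open_baseSet.mem_nhds
        (FiberBundle.mem_baseSet_trivializationAt' x))] with δ hδ hδ'
    change (extChartAt I x (L.hproj δ), (trivializationAt (ℝ →L[ℝ] ℝ) L.DualFib x δ.1).2) = _
    refine Prod.ext rfl ?_
    ext
    change (trivializationAt ℝ (Trivial M ℝ) x).continuousLinearMapAt ℝ (L.hproj δ)
      (δ.1.2 ((trivializationAt ℝ L.Fib x).symmL ℝ (L.hproj δ) 1)) =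
      L.form δ (s (L.hproj δ)) • (1 : ℝ)
    rw [Bundle.Trivialization.symmL_apply _ hδ', hδ, smul_eq_mul, mul_one]
    simp
    rfl
  suffices hz : mfderiv J 𝓘(ℝ, E × (ℝ →L[ℝ] ℝ)) (extChartAt J ε) ε w = 0 by
    rw [← hA] at hz
    exact A.map_eq_zero_iff.1 hz
  have d1 : HasMFDerivAt J 𝓘(ℝ, E) (fun δ => extChartAt I x (L.hproj δ)) ε _ :=
    (mdifferentiableAt_extChartAt (I := I) (mem_chart_source H x)).hasMFDerivAt.comp ε
      hp.hasMFDerivAt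
  have d2 : HasMFDerivAt J 𝓘(ℝ, ℝ →L[ℝ] ℝ) (fun δ =>
      ContinuousLinearMap.toSpanSingleton ℝ (ContinuousLinearMap.id ℝ ℝ) (L.hsec s δ)) ε _ :=
    (ContinuousLinearMap.hasMFDerivAt
      (ContinuousLinearMap.toSpanSingleton ℝ (ContinuousLinearMap.id ℝ ℝ))).comp ε
      (L.mdiff_hsec s ε).hasMFDerivAt
  have d3 : MDifferentiableAt J 𝓘(ℝ, E × (ℝ →L[ℝ] ℝ)) F ε :=
    d1.mdifferentiableAt.prodMk_space d2.mdifferentiableAt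
  have f1 := (ContinuousLinearMap.hasMFDerivAt (ContinuousLinearMap.fst ℝ E (ℝ →L[ℝ] ℝ))
    (x := F ε)).comp ε d3.hasMFDerivAt
  have f2 := (ContinuousLinearMap.hasMFDerivAt (ContinuousLinearMap.snd ℝ E (ℝ →L[ℝ] ℝ))
    (x := F ε)).comp ε d3.hasMFDerivAt
  have e1 := congrArg (fun A => A w) (hasMFDerivAt_unique f1 d1)
  have e2 := congrArg (fun A => A w) (hasMFDerivAt_unique f2 d2)
  rw [hev.mfderiv_eq]
  refine Prod.ext (e1.trans ?_) (e2.trans ?_)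
  · change mfderiv I 𝓘(ℝ, E) (extChartAt I x) x (mfderiv J I L.hproj ε w) = 0
    rw [h1, map_zero]
  · change ContinuousLinearMap.toSpanSingleton ℝ (ContinuousLinearMap.id ℝ ℝ)
      (mvfderiv J (L.hsec s) ε w) = 0
    rw [h2, map_zero]

variable [FiniteDimensional ℝ E] [T2Space M]

theorem exists_frame (L : LineBundle I M) (x : M) : ∃ (s : L.Sec) (ψ : C^∞⟮I, M; ℝ⟯),
    (∀ᶠ y in 𝓝 x, ψ y = 1) ∧
    (∀ᶠ y in 𝓝 x, s y = (trivializationAt ℝ L.Fib x).symm y 1) ∧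
    (∀ lam : L.Sec, ∃ f : C^∞⟮I, M; ℝ⟯, L.fsmul f s = L.fsmul ψ lam) := by
  set e := trivializationAt ℝ L.Fib x with he
  have hx : x ∈ e.baseSet := FiberBundle.mem_baseSet_trivializationAt' x
  obtain ⟨φ, hφ⟩ := (SmoothBumpFunction.nhds_basis_tsupport (I := I) x).mem_iff.1
    (e.open_baseSet.mem_nhds hx)
  have hφt : tsupport φ ⊆ e.baseSet := hφ.2
  have hframe : ContMDiffOn I (I.prod 𝓘(ℝ, ℝ)) ∞
      (fun y => (⟨y, e.symm y 1⟩ : L.Tot)) e.baseSet := by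
    have h1 := (e.contMDiffOn_symm (IB := I) (n := ∞)).comp
      (contMDiffOn_id.prodMk (contMDiffOn_const (c := (1 : ℝ)) (s := e.baseSet) (I := I)))
      (fun y hy => by rw [mem_preimage, e.target_eq]; exact ⟨hy, mem_univ _⟩)
    refine h1.congr fun y hy => ?_
    simp only [Function.comp_apply, id_eq]
    rw [← e.mk_symm hy]
  have hs : ContMDiff I (I.prod 𝓘(ℝ, ℝ)) ∞
      (fun y => (⟨y, ((φ : M → ℝ) • fun y => (e.symm y 1 : L.Fib y)) y⟩ : L.Tot)) :=
    ContMDiffOn.smul_section_of_tsupport (φ.contMDiff.contMDiffOn) e.open_baseSet hφt hframe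
  set ψ : C^∞⟮I, M; ℝ⟯ := ⟨fun y => φ y * φ y, φ.contMDiff.mul φ.contMDiff⟩ with hψ
  refine ⟨⟨_, hs⟩, ψ, ?_, ?_, fun lam => ?_⟩
  · filter_upwards [φ.eventuallyEq_one] with y hy
    change φ y * φ y = 1
    rw [hy]; simp
  · filter_upwards [φ.eventuallyEq_one] with y hy
    change φ y • (e.symm y 1 : L.Fib y) = _
    rw [hy]; simp
  · have hc : ContMDiffOn I 𝓘(ℝ, ℝ) ∞ (fun y => (e ⟨y, lam y⟩).2) e.baseSet :=
      (e.contMDiffOn_section_baseSet_iff).1 lam.contMDiff.contMDiffOn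
    have hf : ContMDiff I 𝓘(ℝ, ℝ) ∞ (fun y => φ y • (e ⟨y, lam y⟩).2) := by
      refine contMDiff_of_tsupport fun y hy => ?_
      have hy' : y ∈ e.baseSet := hφt (closure_mono (Function.support_smul_subset_left _ _) hy)
      exact φ.contMDiffAt.smul (hc.contMDiffAt (e.open_baseSet.mem_nhds hy'))
    refine ⟨⟨_, hf⟩, ?_⟩
    ext y
    change (φ y • (e ⟨y, lam y⟩).2) • (φ y • (e.symm y 1 : L.Fib y)) = (φ y * φ y) • lam y
    by_cases hy : y ∈ e.baseSet
    · set A := e.continuousLinearEquivAt ℝ y hy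
      have h1 : (e ⟨y, lam y⟩).2 = A (lam y) := rfl
      have h2 : e.symm y 1 = A.symm 1 := by
        simp only [A, Bundle.Trivialization.symm_continuousLinearEquivAt_eq]
        rw [Bundle.Trivialization.symmL_apply e hy]
      have h3 : lam y = A (lam y) • A.symm 1 := by
        rw [← map_smul, smul_eq_mul, mul_one, A.symm_apply_apply]
      rw [h1, h2]
      conv_rhs => rw [h3]
      rw [smul_smul, smul_smul, smul_eq_mul]
      congr 1; ring
    · have : φ y = 0 := by
        by_contra h
        exact hy (hφt (subset_tsupport _ h))
      rw [this]; simp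

theorem eq_zero_of_mvfderiv {x : M} (v : TangentSpace I x)
    (h : ∀ f : C^∞⟮I, M; ℝ⟯, mvfderiv I f x v = 0) : v = 0 := by
  have hinv := (isInvertible_mfderiv_extChartAt (I := I) (mem_extChartAt_source (I := I) x))
  obtain ⟨A, hA⟩ := hinv
  obtain ⟨φ⟩ : Nonempty (SmoothBumpFunction I x) := inferInstance
  obtain ⟨z, hz⟩ : ∃ z : E, z = mfderiv I 𝓘(ℝ, E) (extChartAt I x) x v := ⟨_, rfl⟩
  suffices h0 : z = 0 by
    rw [hz, ← hA] at h0
    exact A.map_eq_zero_iff.1 h0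
  by_contra hne
  obtain ⟨ℓ, -, hℓ⟩ := exists_dual_vector ℝ z (norm_ne_zero_iff.2 hne)
  have hf : ContMDiff I 𝓘(ℝ, ℝ) ∞ (fun y => φ y • ℓ (extChartAt I x y)) :=
    φ.contMDiff_smul ((ℓ.contMDiff).comp_contMDiffOn contMDiffOn_extChartAt)
  have h1 := h ⟨_, hf⟩
  have h2 : (fun y => φ y • ℓ (extChartAt I x y)) =ᶠ[𝓝 x] ℓ ∘ extChartAt I x := by
    filter_upwards [φ.eventuallyEq_one] with y hy
    rw [hy]; simp
  have h3 : mvfderiv I (fun y => φ y • ℓ (extChartAt I x y)) x v = ℓ z := by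
    change (mfderiv I 𝓘(ℝ, ℝ) _ x v : ℝ) = _
    rw [h2.mfderiv_eq, mfderiv_comp x (ℓ.differentiableAt.mdifferentiableAt)
      (mdifferentiableAt_extChartAt (mem_chart_source H x)), hz]
    rw [mfderiv_eq_fderiv, ContinuousLinearMap.fderiv]
    rfl
  have h4 : ℓ z = 0 := h3.symm.trans h1
  rw [hℓ] at h4
  exact hne (norm_eq_zero.1 (by exact_mod_cast h4))

theorem pT_bijective (L : LineBundle I M) (ε : L.Hgz) : Function.Bijective (L.pT ε) := by
  set x := L.hproj ε with hx
  set J := I.prod 𝓘(ℝ, ℝ →L[ℝ] ℝ) with hJ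
  obtain ⟨s, ψ, hψ, hs, hf⟩ := L.exists_frame x
  have hsx : s x ≠ 0 := by
    rw [hs.self_of_nhds]
    have hxb : x ∈ (trivializationAt ℝ L.Fib x).baseSet :=
      FiberBundle.mem_baseSet_trivializationAt' x
    set A := (trivializationAt ℝ L.Fib x).continuousLinearEquivAt ℝ x hxb
    have h2 : (trivializationAt ℝ L.Fib x).symm x 1 = A.symm 1 := by
      simp only [A, Bundle.Trivialization.symm_continuousLinearEquivAt_eq]
      rw [Bundle.Trivialization.symmL_apply _ hxb]
    rw [h2]
    simp
  let K : L.HT ε →ₗ[ℝ] TangentSpace I x × ℝ :=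
    (mfderiv J I L.hproj ε).toLinearMap.prod (mvfderiv J (L.hsec s) ε).toLinearMap
  have hK : Function.Injective K := by
    rw [injective_iff_map_eq_zero]
    intro w hw
    exact L.hgz_eq_zero ε w hs (congrArg Prod.fst hw) (congrArg Prod.snd hw)
  have hKs : Function.Surjective K := by
    have : FiniteDimensional ℝ (L.HT ε) :=
      inferInstanceAs (FiniteDimensional ℝ (E × (ℝ →L[ℝ] ℝ)))
    have : FiniteDimensional ℝ (TangentSpace I x) := inferInstanceAs (FiniteDimensional ℝ E)
    refine (LinearMap.injective_iff_surjective_of_finrank_eq_finrank ?_).1 hK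
    rw [Module.finrank_prod]
    change Module.finrank ℝ (E × (ℝ →L[ℝ] ℝ)) = Module.finrank ℝ E + _
    rw [Module.finrank_prod]
    congr 1
    rw [← (LinearMap.toContinuousLinearMap (𝕜 := ℝ) (E := ℝ) (F' := ℝ)).finrank_eq]
    simp
  have hval : ∀ w, (L.pT ε w : L.Sec →ₗ[ℝ] L.Fib x) s = L.pL ε (mvfderiv J (L.hsec s) ε w) :=
    fun w => rfl
  constructor
  · rw [injective_iff_map_eq_zero]
    intro w hw
    have h2 : mvfderiv J (L.hsec s) ε w = 0 := by
      have := hval w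
      rw [hw] at this
      exact (L.pL ε).map_eq_zero_iff.1 this.symm
    refine L.hgz_eq_zero ε w hs (eq_zero_of_mvfderiv _ fun f => ?_) h2
    have := L.pT_fsmul ε w f s
    rw [hw] at this
    simp only [ZeroMemClass.coe_zero, LinearMap.zero_apply, smul_zero, add_zero] at this
    exact (smul_eq_zero.1 this.symm).resolve_right hsx
  · rintro ⟨Δ, v, hv⟩
    obtain ⟨w, hw⟩ := hKs (v, L.form ε (Δ s))
    have hw1 : mfderiv J I L.hproj ε w = v := congrArg Prod.fst hw
    have hw2 : mvfderiv J (L.hsec s) ε w = L.form ε (Δ s) := congrArg Prod.snd hw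
    refine ⟨w, ?_⟩
    ext lam
    obtain ⟨f, hfl⟩ := hf lam
    rw [L.D_formula hψ hfl Δ v hv]
    refine (L.D_formula hψ hfl _ _ (L.pT_fsmul ε w)).trans ?_
    rw [hw1, hval, hw2, L.pL_form]

/-- The vector bundle map `p_{T*} : T*M̃ → J¹L`, given by `⟨ε, p_{T*}(θ)(p_T(v))⟩ = θ(v)`. -/
def pTstar (L : LineBundle I M) (ε : L.Hgz) : (L.HT ε →L[ℝ] ℝ) →ₗ[ℝ] L.J (L.hproj ε) where
  toFun θ := (L.pL ε : ℝ →ₗ[ℝ] L.Fib (L.hproj ε)) ∘ₗ (θ : L.HT ε →ₗ[ℝ] ℝ) ∘ₗ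
    ((LinearEquiv.ofBijective (L.pT ε) (L.pT_bijective ε)).symm : L.D (L.hproj ε) →ₗ[ℝ] L.HT ε)
  map_add' θ θ' := by ext Δ; simp
  map_smul' c θ := by ext Δ; exact map_smul (L.pL ε) c _

theorem form_pTstar_pT (L : LineBundle I M) (ε : L.Hgz) (θ : L.HT ε →L[ℝ] ℝ) (v : L.HT ε) :
    L.form ε (L.pTstar ε θ (L.pT ε v)) = θ v :=
  (L.form_pL ε _).trans (congrArg θ
    ((LinearEquiv.ofBijective (L.pT ε) (L.pT_bijective ε)).symm_apply_apply v))

end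

end LineBundle

/-- A (regular) line bundle map: a smooth vector bundle map which is an isomorphism on fibers. -/
structure LineBundleMap {E : Type*} [NormedAddCommGroup E] [NormedSpace ℝ E]
    {H : Type*} [TopologicalSpace H] {I : ModelWithCorners ℝ E H}
    {M : Type*} [TopologicalSpace M] [ChartedSpace H M]
    {E' : Type*} [NormedAddCommGroup E'] [NormedSpace ℝ E']
    {H' : Type*} [TopologicalSpace H'] {I' : ModelWithCorners ℝ E' H'}
    {N : Type*} [TopologicalSpace N] [ChartedSpace H' N]
    (LN : LineBundle I' N) (L : LineBundle I M) where
  /-- the map between the bases -/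
  base : C^∞⟮I', N; I, M⟯
  /-- the isomorphisms between the fibers -/
  fib : ∀ y, LN.Fib y ≃L[ℝ] L.Fib (base y)
  smooth : ContMDiff (I'.prod 𝓘(ℝ, ℝ)) (I.prod 𝓘(ℝ, ℝ)) ∞
    (fun v : LN.Tot => (⟨base v.1, fib v.1 v.2⟩ : L.Tot))

namespace LineBundleMap

variable {I : ModelWithCorners ℝ E H} {M : Type*} [TopologicalSpace M] [ChartedSpace H M]
  {E' : Type*} [NormedAddCommGroup E'] [NormedSpace ℝ E']
  {H' : Type*} [TopologicalSpace H'] {I' : ModelWithCorners ℝ E' H'}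
  {N : Type*} [TopologicalSpace N] [ChartedSpace H' N]
  {LN : LineBundle I' N} {L : LineBundle I M}

theorem contMDiff_pullSec [IsManifold I' ∞ N] (φ : LineBundleMap LN L) (lam : L.Sec) :
    ContMDiff I' (I'.prod 𝓘(ℝ, ℝ)) ∞
      (fun y => (⟨y, (φ.fib y).symm (lam (φ.base y))⟩ : LN.Tot)) := by
  intro y₀
  rw [contMDiffAt_section]
  set e := trivializationAt ℝ LN.Fib y₀ with he
  set e' := trivializationAt ℝ L.Fib (φ.base y₀) with he'
  have hy₀ : y₀ ∈ e.baseSet := FiberBundle.mem_baseSet_trivializationAt' y₀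
  have hφ₀ : φ.base y₀ ∈ e'.baseSet := FiberBundle.mem_baseSet_trivializationAt' _
  have h1 : ContMDiffAt I' (I'.prod 𝓘(ℝ, ℝ)) ∞
      (fun y => (⟨y, e.symm y 1⟩ : LN.Tot)) y₀ := by
    have := (e.contMDiffOn_symm (IB := I') (n := ∞)).contMDiffAt (x := (y₀, (1 : ℝ)))
      (e.open_target.mem_nhds (by rw [e.target_eq]; exact ⟨hy₀, mem_univ _⟩))
    have h2 := this.comp y₀ (contMDiffAt_id.prodMk contMDiffAt_const)
    refine h2.congr_of_eventuallyEq ?_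
    filter_upwards [e.open_baseSet.mem_nhds hy₀] with y hy
    simp only [Function.comp_apply, id_eq]
    rw [← e.mk_symm hy]
  set a : N → ℝ := fun y => (e' ⟨φ.base y, φ.fib y (e.symm y 1)⟩).2 with ha
  set b : N → ℝ := fun y => (e' ⟨φ.base y, lam (φ.base y)⟩).2 with hb
  have hsa : ContMDiffAt I' 𝓘(ℝ, ℝ) ∞ a y₀ := by
    have := ContMDiffAt.comp y₀ (φ.smooth.contMDiffAt (x := ⟨y₀, e.symm y₀ 1⟩)) h1
    exact (contMDiffAt_totalSpace.1 this).2
  have hsb : ContMDiffAt I' 𝓘(ℝ, ℝ) ∞ b y₀ := by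
    have := ContMDiffAt.comp y₀ (lam.contMDiff.contMDiffAt (x := φ.base y₀))
      φ.base.contMDiff.contMDiffAt
    exact (contMDiffAt_totalSpace.1 this).2
  have key : ∀ y ∈ e.baseSet, φ.base y ∈ e'.baseSet → a y ≠ 0 ∧
      (e ⟨y, (φ.fib y).symm (lam (φ.base y))⟩).2 = (a y)⁻¹ * b y := by
    intro y hy hy'
    set A := e.continuousLinearEquivAt ℝ y hy
    set B := e'.continuousLinearEquivAt ℝ (φ.base y) hy'
    have haA : a y = B (φ.fib y (A.symm 1)) := by
      simp only [ha, A, B, Bundle.Trivialization.continuousLinearEquivAt_apply,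
        Bundle.Trivialization.symm_continuousLinearEquivAt_eq]
      rw [Bundle.Trivialization.symmL_apply e hy]
    have hbB : b y = B (lam (φ.base y)) := rfl
    have hcA : (e ⟨y, (φ.fib y).symm (lam (φ.base y))⟩).2
        = A ((φ.fib y).symm (lam (φ.base y))) := rfl
    have hne : a y ≠ 0 := by
      rw [haA]
      simp
    refine ⟨hne, ?_⟩
    rw [hcA, hbB, eq_inv_mul_iff_mul_eq₀ hne, haA]
    set w := (φ.fib y).symm (lam (φ.base y)) with hw
    have hlw : lam (φ.base y) = φ.fib y w := by simp [hw]
    have hwA : w = A w • A.symm 1 := by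
      rw [← map_smul, smul_eq_mul, mul_one, A.symm_apply_apply]
    rw [hlw]
    conv_rhs => rw [hwA, map_smul, map_smul, smul_eq_mul, mul_comm]
  refine ((hsa.inv₀ (key y₀ hy₀ hφ₀).1).mul hsb).congr_of_eventuallyEq ?_
  filter_upwards [e.open_baseSet.mem_nhds hy₀,
    φ.base.contMDiff.continuous.continuousAt.preimage_mem_nhds
      (e'.open_baseSet.mem_nhds hφ₀)] with y hy hy'
  exact (key y hy hy').2

/-- The pull-back `φ^*λ` of a section. -/
def pullSec [IsManifold I' ∞ N] (φ : LineBundleMap LN L) (lam : L.Sec) : LN.Sec :=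
  ⟨fun y => (φ.fib y).symm (lam (φ.base y)), φ.contMDiff_pullSec lam⟩

/-- The map `Dφ : DL_N → DL` induced by a line bundle map, `Dφ(Δ) λ = φ(Δ(φ^*λ))`, on the fiber
over a point. -/
def D [IsManifold I' ∞ N] (φ : LineBundleMap LN L) (y : N) : LN.D y →ₗ[ℝ] L.D (φ.base y) where
  toFun Δ := ⟨{
      toFun := fun lam => φ.fib y ((Δ : LN.Sec →ₗ[ℝ] LN.Fib y) (φ.pullSec lam))
      map_add' := by
        intro a b
        have h : φ.pullSec (a + b) = φ.pullSec a + φ.pullSec b := by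
          ext z; simp [pullSec]
        rw [h, map_add, map_add]
      map_smul' := by
        intro c a
        have h : φ.pullSec (c • a) = c • φ.pullSec a := by
          ext z; simp [pullSec]
        rw [h, map_smul, map_smul, RingHom.id_apply] }, by
    obtain ⟨Δ, v, hv⟩ := Δ
    refine ⟨mfderiv I' I φ.base y v, fun f lam => ?_⟩
    have h : φ.pullSec (L.fsmul f lam) = LN.fsmul (f.comp φ.base) (φ.pullSec lam) := by
      ext z; simp [pullSec, LineBundle.fsmul]
    have hd : mvfderiv I' (f.comp φ.base) y v
        = mvfderiv I f (φ.base y) (mfderiv I' I φ.base y v) :=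
      mvfderiv_comp_apply y (f.contMDiff.mdifferentiable (by simp) _)
        (φ.base.contMDiff.mdifferentiable (by simp) _) v
    simp only [LinearMap.coe_mk, AddHom.coe_mk]
    rw [h, hv, map_add, map_smul, map_smul, hd]
    simp [pullSec]⟩
  map_add' Δ Δ' := by
    ext lam
    simp
  map_smul' c Δ := by
    ext lam
    simp

/-- The map `Dφ : DL_N → DL` on total spaces. -/
def DTot [IsManifold I' ∞ N] (φ : LineBundleMap LN L) (Δ : Σ y, LN.D y) : Σ x, L.D x :=
  ⟨φ.base Δ.1, φ.D Δ.1 Δ.2⟩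

/-- The homogenization `φ̃ : Ñ → M̃` of a line bundle map: the restriction to the slit dual bundles
of the fiberwise inverse of the transpose of `φ`. -/
def hgz (φ : LineBundleMap LN L) (ε : LN.Hgz) : L.Hgz :=
  ⟨⟨φ.base (LN.hproj ε),
    (LN.form ε).comp ((φ.fib (LN.hproj ε)).symm : L.Fib (φ.base (LN.hproj ε)) →L[ℝ] _)⟩, by
    intro h
    apply ε.2
    ext v
    have h' : LN.form ε ((φ.fib (LN.hproj ε)).symm (φ.fib (LN.hproj ε) v)) = 0 :=
      congrArg (fun f => f (φ.fib (LN.hproj ε) v)) h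
    exact (congrArg (LN.form ε) ((φ.fib (LN.hproj ε)).symm_apply_apply v)).symm.trans h'⟩

end LineBundleMap
end LineBundles

section Groupoids

variable {EM : Type*} [NormedAddCommGroup EM] [NormedSpace ℝ EM]
  {HM : Type*} [TopologicalSpace HM] {IM : ModelWithCorners ℝ EM HM}
  {M : Type*} [TopologicalSpace M] [ChartedSpace HM M]
  {EG : Type*} [NormedAddCommGroup EG] [NormedSpace ℝ EG]
  {HG : Type*} [TopologicalSpace HG] {IG : ModelWithCorners ℝ EG HG}
  {G : Type*} [TopologicalSpace G] [ChartedSpace HG G]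
  {EP : Type*} [NormedAddCommGroup EP] [NormedSpace ℝ EP]
  {HP : Type*} [TopologicalSpace HP] {IP : ModelWithCorners ℝ EP HP}
  {P : Type*} [TopologicalSpace P] [ChartedSpace HP P]

/-! ### Tensors and their homogenization -/

/-- The fiber over `x` of the tensor bundle `(T*M)^{⊗l} ⊗ (TM)^{⊗m}`, seen as the space of
multilinear maps `(T_xM)^l × (T*_xM)^m → ℝ`. -/
abbrev TensorFib (IM : ModelWithCorners ℝ EM HM) {M : Type*} [TopologicalSpace M]
    [ChartedSpace HM M] (l m : ℕ) (x : M) : Type _ :=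
  MultilinearMap ℝ (fun _ : Fin l => TangentSpace IM x)
    (MultilinearMap ℝ (fun _ : Fin m => TangentSpace IM x →L[ℝ] ℝ) ℝ)

/-- The homogenization `T̃` of an Atiyah `(l, m)`-tensor `T`, an `(l, m)`-tensor on `M̃`:
`T̃(v₁, …, v_l; θ₁, …, θ_m) = ⟨ε, T(p_T v₁, …, p_T v_l; p_{T*} θ₁, …, p_{T*} θ_m)⟩`
for `v_i` in `T_εM̃` and `θ_j` in `T*_εM̃`. -/
def LineBundle.AtiyahTensor.hgz [FiniteDimensional ℝ EM] [IsManifold IM ∞ M] [T2Space M]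
    {L : LineBundle IM M} {l m : ℕ} (T : L.AtiyahTensor l m)
    (ε : L.Hgz) : TensorFib (IM.prod 𝓘(ℝ, ℝ →L[ℝ] ℝ)) l m ε :=
  LinearMap.compMultilinearMap
    { toFun := fun S : MultilinearMap ℝ (fun _ : Fin m => L.J (L.hproj ε)) (L.Fib (L.hproj ε)) =>
        (L.form ε : L.Fib (L.hproj ε) →ₗ[ℝ] ℝ).compMultilinearMap
          (S.compLinearMap (fun _ => L.pTstar ε))
      map_add' := fun S S' => by ext; simp
      map_smul' := fun c S => by ext; simp }
    ((T.toFun (L.hproj ε)).compLinearMap (fun _ => L.pT ε))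

theorem LineBundle.AtiyahTensor.hgz_apply [FiniteDimensional ℝ EM] [IsManifold IM ∞ M]
    [T2Space M] {L : LineBundle IM M} {l m : ℕ} (T : L.AtiyahTensor l m)
    (ε : L.Hgz) (v : Fin l → L.HT ε) (θ : Fin m → (L.HT ε →L[ℝ] ℝ)) :
    T.hgz ε v θ = L.form ε
      (T.toFun (L.hproj ε) (fun i => L.pT ε (v i)) (fun j => L.pTstar ε (θ j))) := rfl

/-! ### Lie groupoids, tangent and cotangent groupoids -/

/-- The structure maps of a groupoid `G ⇉ M` whose space of composable pairs is `P`. -/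
structure GroupoidMaps (M G P : Type*) where
  /-- source -/
  src : G → M
  /-- target -/
  tgt : G → M
  /-- first projection of a composable pair -/
  pr₁ : P → G
  /-- second projection of a composable pair -/
  pr₂ : P → G
  /-- multiplication -/
  mul : P → G
  /-- units -/
  one : M → G
  /-- inversion -/
  inv : G → G

/-- A Lie groupoid `G ⇉ M`. The fibered product `G ₛ×ₜ G` of composable pairs `(g, h)`,
`s(g) = t(h)`, is presented as a manifold `P` embedded in `G × G` by its two projections. -/
structure LieGroupoid (IM : ModelWithCorners ℝ EM HM) (M : Type*) [TopologicalSpace M]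
    [ChartedSpace HM M] (IG : ModelWithCorners ℝ EG HG) (G : Type*) [TopologicalSpace G]
    [ChartedSpace HG G] (IP : ModelWithCorners ℝ EP HP) (P : Type*) [TopologicalSpace P]
    [ChartedSpace HP P] where
  /-- source -/
  src : C^∞⟮IG, G; IM, M⟯
  /-- target -/
  tgt : C^∞⟮IG, G; IM, M⟯
  /-- first projection of a composable pair -/
  pr₁ : C^∞⟮IP, P; IG, G⟯
  /-- second projection of a composable pair -/
  pr₂ : C^∞⟮IP, P; IG, G⟯
  /-- multiplication -/
  mul : C^∞⟮IP, P; IG, G⟯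
  /-- units -/
  one : C^∞⟮IM, M; IG, G⟯
  /-- inversion -/
  inv : C^∞⟮IG, G; IG, G⟯
  src_submersion : Manifold.IsSubmersion IG IM ∞ src
  tgt_submersion : Manifold.IsSubmersion IG IM ∞ tgt
  pair_embedding : Manifold.IsSmoothEmbedding IP (IG.prod IG) ∞ (fun c => (pr₁ c, pr₂ c))
  src_pr₁ : ∀ c, src (pr₁ c) = tgt (pr₂ c)
  exists_pair : ∀ g h, src g = tgt h → ∃ c, pr₁ c = g ∧ pr₂ c = h
  src_mul : ∀ c, src (mul c) = src (pr₂ c)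
  tgt_mul : ∀ c, tgt (mul c) = tgt (pr₁ c)
  src_one : ∀ x, src (one x) = x
  tgt_one : ∀ x, tgt (one x) = x
  src_inv : ∀ g, src (inv g) = tgt g
  tgt_inv : ∀ g, tgt (inv g) = src g
  one_mul : ∀ c, pr₁ c = one (tgt (pr₂ c)) → mul c = pr₂ c
  mul_one : ∀ c, pr₂ c = one (src (pr₁ c)) → mul c = pr₁ c
  inv_mul : ∀ c, pr₁ c = inv (pr₂ c) → mul c = one (src (pr₂ c))
  mul_inv : ∀ c, pr₂ c = inv (pr₁ c) → mul c = one (tgt (pr₁ c))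
  mul_assoc : ∀ a b c d, pr₂ a = pr₁ b → pr₁ c = mul a → pr₂ c = pr₂ b →
    pr₁ d = pr₁ a → pr₂ d = mul b → mul c = mul d

namespace GroupoidMaps

/-- The graph of the multiplication of the tangent groupoid `TG ⇉ TM`: the composable pairs of `TG`
are the pairs `(d pr₁ ξ, d pr₂ ξ)`, with `ξ` a tangent vector to the manifold of composable pairs,
and their product is `dm ξ`. -/
def TangentMul (IG : ModelWithCorners ℝ EG HG) (IP : ModelWithCorners ℝ EP HP)
    (𝒢 : GroupoidMaps M G P) (V W U : TangentBundle IG G) : Prop :=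
  ∃ ξ : TangentBundle IP P, tangentMap IP IG 𝒢.pr₁ ξ = V ∧ tangentMap IP IG 𝒢.pr₂ ξ = W ∧
    tangentMap IP IG 𝒢.mul ξ = U

/-- The fiber `A_x = ker (ds)` over the unit at `x` of the Lie algebroid of `G ⇉ M`. -/
def Alg (IM : ModelWithCorners ℝ EM HM) (IG : ModelWithCorners ℝ EG HG)
    (𝒢 : GroupoidMaps M G P) (x : M) : Submodule ℝ (TangentSpace IG (𝒢.one x)) :=
  LinearMap.ker (mfderiv IG IM 𝒢.src (𝒢.one x)).toLinearMap

/-- Covectors `η` at `g` and `θ` at `h`, where `c = (g, h)`, are composable in the cotangent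
groupoid `T*G ⇉ A*`, i.e. `s(η) = t(θ)` in `A*_x`, `x = s(g) = t(h)`, where
`⟨s(η), a⟩ = - ⟨η, 0_g · a⁻¹⟩` and `⟨t(θ), a⟩ = ⟨θ, a · 0_h⟩`, the products being those in `TG`. -/
def CotangentComposable (IM : ModelWithCorners ℝ EM HM) (IG : ModelWithCorners ℝ EG HG)
    (IP : ModelWithCorners ℝ EP HP) (𝒢 : GroupoidMaps M G P) (c : P)
    (η : TangentSpace IG (𝒢.pr₁ c) →L[ℝ] ℝ) (θ : TangentSpace IG (𝒢.pr₂ c) →L[ℝ] ℝ) : Prop :=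
  ∀ a ∈ 𝒢.Alg IM IG (𝒢.src (𝒢.pr₁ c)),
    ∀ (u : TangentSpace IG (𝒢.pr₁ c)) (w : TangentSpace IG (𝒢.pr₂ c)),
      𝒢.TangentMul IG IP ⟨𝒢.pr₁ c, 0⟩ (tangentMap IG IG 𝒢.inv ⟨_, a⟩) ⟨𝒢.pr₁ c, u⟩ →
      𝒢.TangentMul IG IP ⟨_, a⟩ ⟨𝒢.pr₂ c, 0⟩ ⟨𝒢.pr₂ c, w⟩ →
      - η u = θ w

/-- The graph of the multiplication of the cotangent groupoid: `κ = η · θ` iff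
`⟨κ, v · w⟩ = ⟨η, v⟩ + ⟨θ, w⟩` for all composable tangent vectors `v, w`. -/
def CotangentMul (IG : ModelWithCorners ℝ EG HG) (IP : ModelWithCorners ℝ EP HP)
    (𝒢 : GroupoidMaps M G P) (c : P) (η : TangentSpace IG (𝒢.pr₁ c) →L[ℝ] ℝ)
    (θ : TangentSpace IG (𝒢.pr₂ c) →L[ℝ] ℝ) (κ : TangentSpace IG (𝒢.mul c) →L[ℝ] ℝ) : Prop :=
  ∀ ξ : TangentSpace IP c, κ (mfderiv IP IG 𝒢.mul c ξ) =
    η (mfderiv IP IG 𝒢.pr₁ c ξ) + θ (mfderiv IP IG 𝒢.pr₂ c ξ)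

/-- An `(l, m)`-tensor `T` on `G` is multiplicative if `f_T(Θ₁ · Θ₂) = f_T(Θ₁) + f_T(Θ₂)` for all
composable arrows `Θ₁, Θ₂` of the groupoid `TG ×_G ⋯ ×_G TG ×_G T*G ×_G ⋯ ×_G T*G`
(`l` factors `TG`, `m` factors `T*G`). Here `Θ₁` and `Θ₂` are over the arrows `g` and `h`,
`c = (g, h)`, their tangent components are composable via the `ξ i`, their cotangent components are
`η` and `θ`, and the cotangent components of the product are `κ`. -/
def IsMultiplicativeTensor (IM : ModelWithCorners ℝ EM HM) (IG : ModelWithCorners ℝ EG HG)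
    (IP : ModelWithCorners ℝ EP HP) (𝒢 : GroupoidMaps M G P) {l m : ℕ}
    (T : ∀ g : G, TensorFib IG l m g) : Prop :=
  ∀ (c : P) (ξ : Fin l → TangentSpace IP c)
    (η : Fin m → (TangentSpace IG (𝒢.pr₁ c) →L[ℝ] ℝ))
    (θ : Fin m → (TangentSpace IG (𝒢.pr₂ c) →L[ℝ] ℝ))
    (κ : Fin m → (TangentSpace IG (𝒢.mul c) →L[ℝ] ℝ)),
    (∀ j, 𝒢.CotangentComposable IM IG IP c (η j) (θ j)) →
    (∀ j, 𝒢.CotangentMul IG IP c (η j) (θ j) (κ j)) →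
    T (𝒢.mul c) (fun i => mfderiv IP IG 𝒢.mul c (ξ i)) κ =
      T (𝒢.pr₁ c) (fun i => mfderiv IP IG 𝒢.pr₁ c (ξ i)) η +
      T (𝒢.pr₂ c) (fun i => mfderiv IP IG 𝒢.pr₂ c (ξ i)) θ

end GroupoidMaps

namespace LieGroupoid

/-- The underlying structure maps of a Lie groupoid. -/
def maps (𝒢 : LieGroupoid IM M IG G IP P) : GroupoidMaps M G P :=
  ⟨𝒢.src, 𝒢.tgt, 𝒢.pr₁, 𝒢.pr₂, 𝒢.mul, 𝒢.one, 𝒢.inv⟩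

/-! ### LB-groupoids -/

/-- A smooth linear action of a Lie groupoid `G ⇉ M` on a line bundle `L → M`. Such an action is
the same as an LB-groupoid `(t^*L ⇉ 0_M; G ⇉ M)`, with multiplication
`(g, ℓ) · (h, ℓ') = (gh, ℓ + g.ℓ')`. -/
structure LineAction (𝒢 : LieGroupoid IM M IG G IP P) (L : LineBundle IM M) where
  /-- the action `ℓ ↦ g.ℓ` -/
  act : ∀ g, L.Fib (𝒢.src g) ≃L[ℝ] L.Fib (𝒢.tgt g)
  smooth : ContMDiff (IG.prod 𝓘(ℝ, ℝ)) (IM.prod 𝓘(ℝ, ℝ)) ∞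
    (fun v : (L.pullback 𝒢.src).Tot => (⟨𝒢.tgt v.1, act v.1 v.2⟩ : L.Tot))
  act_one : ∀ x (ℓ : L.Fib (𝒢.src (𝒢.one x))),
    (⟨𝒢.tgt (𝒢.one x), act (𝒢.one x) ℓ⟩ : L.Tot) = ⟨𝒢.src (𝒢.one x), ℓ⟩
  act_mul : ∀ c (ℓ : L.Fib (𝒢.src (𝒢.pr₂ c))),
    (⟨𝒢.tgt (𝒢.mul c), act (𝒢.mul c) (L.castFib (𝒢.src_mul c).symm ℓ)⟩ : L.Tot) =
      ⟨𝒢.tgt (𝒢.pr₁ c), act (𝒢.pr₁ c) (L.castFib (𝒢.src_pr₁ c).symm (act (𝒢.pr₂ c) ℓ))⟩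

end LieGroupoid

theorem LineBundle.contMDiff_lift {L : LineBundle IM M} (f : C^∞⟮IG, G; IM, M⟯) :
    ContMDiff (IG.prod 𝓘(ℝ, ℝ)) (IM.prod 𝓘(ℝ, ℝ)) ∞
      (fun v : (L.pullback f).Tot => (⟨f v.1, v.2⟩ : L.Tot)) := by
  intro v
  rw [contMDiffAt_totalSpace]
  have h := contMDiffAt_totalSpace.1
    (contMDiffAt_id (I := IG.prod 𝓘(ℝ, ℝ)) (n := ∞) (x := v))
  exact ⟨f.contMDiff.contMDiffAt.comp v h.1, h.2⟩

theorem LineBundle.contMDiff_pullback {L : LineBundle IM M} {f : C^∞⟮IG, G; IM, M⟯}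
    {Φ : P → (L.pullback f).Tot} (h₁ : ContMDiff IP IG ∞ (fun p => (Φ p).1))
    (h₂ : ContMDiff IP (IM.prod 𝓘(ℝ, ℝ)) ∞ (fun p => (⟨f (Φ p).1, (Φ p).2⟩ : L.Tot))) :
    ContMDiff IP (IG.prod 𝓘(ℝ, ℝ)) ∞ Φ := by
  intro p
  rw [contMDiffAt_totalSpace]
  exact ⟨h₁ p, (contMDiffAt_totalSpace.1 (h₂ p)).2⟩

namespace LieGroupoid

variable (𝒢 : LieGroupoid IM M IG G IP P) {L : LineBundle IM M}

/-- The line bundle `L_G = t^*L` over `G`. -/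
abbrev LG (L : LineBundle IM M) : LineBundle IG G := L.pullback 𝒢.tgt

/-- The line bundle `m^*L_G` over the manifold of composable pairs. -/
abbrev LP (L : LineBundle IM M) : LineBundle IP P := (𝒢.LG L).pullback 𝒢.mul

/-- The line bundle map `L_G → L` over the target. -/
def tL (L : LineBundle IM M) : LineBundleMap (𝒢.LG L) L where
  base := 𝒢.tgt
  fib g := ContinuousLinearEquiv.refl ℝ (L.Fib (𝒢.tgt g))
  smooth := LineBundle.contMDiff_lift 𝒢.tgt

/-- The line bundle map `m^*L_G → L_G` over the multiplication. -/
def mL (L : LineBundle IM M) : LineBundleMap (𝒢.LP L) (𝒢.LG L) where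
  base := 𝒢.mul
  fib c := ContinuousLinearEquiv.refl ℝ ((𝒢.LG L).Fib (𝒢.mul c))
  smooth := LineBundle.contMDiff_lift 𝒢.mul

/-- The line bundle map `m^*L_G ≅ pr₁^*L_G → L_G` over the first projection, where `m^*L_G` and
`pr₁^*L_G` are identified using `t ∘ m = t ∘ pr₁`. -/
def p₁L (L : LineBundle IM M) : LineBundleMap (𝒢.LP L) (𝒢.LG L) where
  base := 𝒢.pr₁
  fib c := (L.castFib (𝒢.tgt_mul c) : L.Fib (𝒢.tgt (𝒢.mul c)) ≃L[ℝ] L.Fib (𝒢.tgt (𝒢.pr₁ c)))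
  smooth := by
    apply LineBundle.contMDiff_pullback
    · exact 𝒢.pr₁.contMDiff.comp (contMDiff_proj _)
    · refine ((LineBundle.contMDiff_lift 𝒢.tgt).comp
        (LineBundle.contMDiff_lift (L := 𝒢.LG L) 𝒢.mul)).congr fun v => ?_
      exact L.mk_castFib (𝒢.tgt_mul v.1) v.2

/-- The line bundle map `L → L_G` over the unit map, `ℓ ↦ (1, ℓ)`. -/
def oneL (L : LineBundle IM M) : LineBundleMap L (𝒢.LG L) where
  base := 𝒢.one
  fib x := (L.castFib (𝒢.tgt_one x).symm : L.Fib x ≃L[ℝ] L.Fib (𝒢.tgt (𝒢.one x)))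
  smooth := by
    apply LineBundle.contMDiff_pullback
    · exact 𝒢.one.contMDiff.comp (contMDiff_proj _)
    · exact contMDiff_id.congr fun v => L.mk_castFib (𝒢.tgt_one v.1).symm v.2

namespace LineAction

variable {𝒢} (ρ : LineAction 𝒢 L)

theorem mk_act {g g' : G} (h : g = g') (ℓ : L.Fib (𝒢.src g)) :
    (⟨𝒢.tgt g, ρ.act g ℓ⟩ : L.Tot) =
      ⟨𝒢.tgt g', ρ.act g' (L.castFib (congrArg 𝒢.src h) ℓ)⟩ := by
  subst h; rfl

theorem act_inv (g : G) (ℓ : L.Fib (𝒢.tgt g)) :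
    (⟨𝒢.tgt (𝒢.inv g), ρ.act (𝒢.inv g) (L.castFib (𝒢.src_inv g).symm ℓ)⟩ : L.Tot) =
      ⟨𝒢.src g, (ρ.act g).symm ℓ⟩ := by
  obtain ⟨c, h₁, h₂⟩ := 𝒢.exists_pair (𝒢.inv g) g (𝒢.src_inv g)
  have hm : 𝒢.mul c = 𝒢.one (𝒢.src g) := by rw [𝒢.inv_mul c (by rw [h₁, h₂]), h₂]
  have e₀ : 𝒢.src g = 𝒢.src (𝒢.pr₂ c) := by rw [h₂]
  set ℓ₀ := (ρ.act g).symm ℓ with hℓ₀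
  have hact : (⟨𝒢.tgt (𝒢.pr₂ c), ρ.act (𝒢.pr₂ c) (L.castFib e₀ ℓ₀)⟩ : L.Tot) = ⟨𝒢.tgt g, ℓ⟩ := by
    have h : L.castFib (congrArg 𝒢.src h₂) (L.castFib e₀ ℓ₀) = ℓ₀ :=
      TotalSpace.mk_inj.1 ((L.mk_castFib _ _).trans (L.mk_castFib _ _))
    rw [ρ.mk_act h₂, h, hℓ₀, ContinuousLinearEquiv.apply_symm_apply]
  have key := ρ.act_mul c (L.castFib e₀ ℓ₀)
  rw [ρ.mk_act hm, ρ.act_one, L.mk_castFib, L.mk_castFib, L.mk_castFib, ρ.mk_act h₁] at key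
  rw [key]
  have h : L.castFib (congrArg 𝒢.src h₁)
      (L.castFib (𝒢.src_pr₁ c).symm (ρ.act (𝒢.pr₂ c) (L.castFib e₀ ℓ₀))) =
        L.castFib (𝒢.src_inv g).symm ℓ :=
    TotalSpace.mk_inj.1 (((L.mk_castFib _ _).trans (L.mk_castFib _ _)).trans
      (hact.trans (L.mk_castFib _ _).symm))
  rw [h]

theorem contMDiff_act_symm : ContMDiff (IG.prod 𝓘(ℝ, ℝ)) (IM.prod 𝓘(ℝ, ℝ)) ∞
    (fun v : (𝒢.LG L).Tot => (⟨𝒢.src v.1, (ρ.act v.1).symm v.2⟩ : L.Tot)) := by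
  have h : ContMDiff (IG.prod 𝓘(ℝ, ℝ)) (IG.prod 𝓘(ℝ, ℝ)) ∞
      (fun v : (𝒢.LG L).Tot => (⟨𝒢.inv v.1, L.castFib (𝒢.src_inv v.1).symm v.2⟩ :
        (L.pullback 𝒢.src).Tot)) := by
    apply LineBundle.contMDiff_pullback
    · exact 𝒢.inv.contMDiff.comp (contMDiff_proj _)
    · exact (LineBundle.contMDiff_lift 𝒢.tgt).congr fun v =>
        L.mk_castFib (𝒢.src_inv v.1).symm v.2
  exact (ρ.smooth.comp h).congr fun v => (ρ.act_inv v.1 v.2).symm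

/-- The line bundle map `L_G → L` over the source, `(g, ℓ) ↦ g⁻¹.ℓ`, i.e. the composition
`s_L ∘ τ⁻¹` of the canonical map `s_L : s^*L → L` and the inverse of the isomorphism
`τ : s^*L → t^*L`, `(g, ℓ) ↦ (g, g.ℓ)`. -/
def sL : LineBundleMap (𝒢.LG L) L where
  base := 𝒢.src
  fib g := ((ρ.act g).symm : L.Fib (𝒢.tgt g) ≃L[ℝ] L.Fib (𝒢.src g))
  smooth := ρ.contMDiff_act_symm

/-- The line bundle map `m^*L_G → L_G` over the second projection, `((g, h), ℓ) ↦ (h, g⁻¹.ℓ)`. -/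
def p₂L : LineBundleMap (𝒢.LP L) (𝒢.LG L) where
  base := 𝒢.pr₂
  fib c := (((L.castFib (𝒢.tgt_mul c)).trans (ρ.act (𝒢.pr₁ c)).symm).trans
    (L.castFib (𝒢.src_pr₁ c)) : L.Fib (𝒢.tgt (𝒢.mul c)) ≃L[ℝ] L.Fib (𝒢.tgt (𝒢.pr₂ c)))
  smooth := by
    apply LineBundle.contMDiff_pullback
    · exact 𝒢.pr₂.contMDiff.comp (contMDiff_proj _)
    · exact (ρ.contMDiff_act_symm.comp (𝒢.p₁L L).smooth).congr fun v =>
        L.mk_castFib (𝒢.src_pr₁ v.1) _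

/-- The line bundle map `L_G → L_G` over the inversion, `(g, ℓ) ↦ (g⁻¹, g⁻¹.ℓ)`. -/
def iL : LineBundleMap (𝒢.LG L) (𝒢.LG L) where
  base := 𝒢.inv
  fib g := ((ρ.act g).symm.trans (L.castFib (𝒢.tgt_inv g).symm) :
    L.Fib (𝒢.tgt g) ≃L[ℝ] L.Fib (𝒢.tgt (𝒢.inv g)))
  smooth := by
    apply LineBundle.contMDiff_pullback
    · exact 𝒢.inv.contMDiff.comp (contMDiff_proj _)
    · exact ρ.contMDiff_act_symm.congr fun v => L.mk_castFib (𝒢.tgt_inv v.1).symm _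

/-- The homogenization `G̃ ⇉ M̃` of an LB-groupoid, obtained from the dual VB-groupoid by removing
the zero section. An arrow of `G̃` is a pair `(g, ε)` with `ε` a nonzero linear form on
`L_{t(g)} ≅ L_{s(g)}`; source and target are `(g, ε) ↦ g⁻¹.ε` and `(g, ε) ↦ ε`, and
`(g, ε) · (h, δ) = (gh, ε)` when `δ = g⁻¹.ε`. -/
def hgz : GroupoidMaps L.Hgz (𝒢.LG L).Hgz (𝒢.LP L).Hgz where
  src := ρ.sL.hgz
  tgt := (𝒢.tL L).hgz
  pr₁ := (𝒢.p₁L L).hgz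
  pr₂ := ρ.p₂L.hgz
  mul := (𝒢.mL L).hgz
  one := (𝒢.oneL L).hgz
  inv := ρ.iL.hgz

/-- The multiplication of the LB-groupoid `L_G`: `(g, ℓ) · (h, ℓ') = (gh, ℓ + g.ℓ')`. -/
def mulLG (c : P) (ℓ : (𝒢.LG L).Fib (𝒢.pr₁ c)) (ℓ' : (𝒢.LG L).Fib (𝒢.pr₂ c)) :
    (𝒢.LG L).Fib (𝒢.mul c) :=
  L.castFib (𝒢.tgt_mul c).symm
    ((show L.Fib (𝒢.tgt (𝒢.pr₁ c)) from ℓ) + ρ.act (𝒢.pr₁ c) (L.castFib (𝒢.src_pr₁ c).symm ℓ'))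

variable [IsManifold IM ∞ M] [IsManifold IG ∞ G] [IsManifold IP ∞ P]

/-- The graph of the multiplication of the groupoid `DL_G ⇉ DL`. The manifold of composable pairs
is identified with `D(m^*L_G)` by mapping `□` to the pair with components the images of `□` under
`D(pr₁)` and `D(pr₂)`, and the product of the pair corresponding to `□` is `Dm(□)`. -/
def DMul (Δ₁ Δ₂ Δ₃ : Σ g, (𝒢.LG L).D g) : Prop :=
  ∃ B : Σ c, (𝒢.LP L).D c,
    (𝒢.p₁L L).DTot B = Δ₁ ∧ ρ.p₂L.DTot B = Δ₂ ∧ (𝒢.mL L).DTot B = Δ₃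

/-- The core of `DL_G ⇉ DL` over `x`: the derivations at the unit at `x` in the kernel of the source
map `s_D`. The symbol identifies it with the fiber `A_x` of the Lie algebroid of `G ⇉ M`; the
derivation corresponding to `a` is `𝔻_a`. -/
def core (x : M) : Submodule ℝ ((𝒢.LG L).D (𝒢.one x)) := LinearMap.ker (ρ.sL.D (𝒢.one x))

/-- Jets `ψ₁` at `g` and `ψ₂` at `h`, where `c = (g, h)`, are composable in the groupoid
`J¹L_G ⇉ A* ⊗ L`, i.e. `s(ψ₁) = t(ψ₂)` in `Hom(A_x, L_x)`, `x = s(g) = t(h)`, where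
`⟨s(ψ₁), a⟩ = - g⁻¹.⟨ψ₁, 0_g · 𝔻_a⁻¹⟩` and `⟨t(ψ₂), a⟩ = ⟨ψ₂, 𝔻_a · 0_h⟩`, the products being those
in `DL_G`. -/
def JetComposable (c : P) (ψ₁ : (𝒢.LG L).J (𝒢.pr₁ c)) (ψ₂ : (𝒢.LG L).J (𝒢.pr₂ c)) : Prop :=
  ∀ a ∈ ρ.core (𝒢.src (𝒢.pr₁ c)),
    ∀ (u : (𝒢.LG L).D (𝒢.pr₁ c)) (w : (𝒢.LG L).D (𝒢.pr₂ c)),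
      ρ.DMul ⟨𝒢.pr₁ c, 0⟩ (ρ.iL.DTot ⟨_, a⟩) ⟨𝒢.pr₁ c, u⟩ →
      ρ.DMul ⟨_, a⟩ ⟨𝒢.pr₂ c, 0⟩ ⟨𝒢.pr₂ c, w⟩ →
      L.castFib (𝒢.src_pr₁ c) (- (ρ.act (𝒢.pr₁ c)).symm (ψ₁ u)) = ψ₂ w

/-- The graph of the multiplication of the groupoid `J¹L_G`: `χ = ψ₁ · ψ₂` iff
`⟨χ, Δ₁ · Δ₂⟩ = ⟨ψ₁, Δ₁⟩ · ⟨ψ₂, Δ₂⟩` (product in `L_G`) for all composable `Δ₁, Δ₂` in `DL_G`. -/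
def JetMul (c : P) (ψ₁ : (𝒢.LG L).J (𝒢.pr₁ c)) (ψ₂ : (𝒢.LG L).J (𝒢.pr₂ c))
    (χ : (𝒢.LG L).J (𝒢.mul c)) : Prop :=
  ∀ B : (𝒢.LP L).D c, χ ((𝒢.mL L).D c B) =
    ρ.mulLG c (ψ₁ ((𝒢.p₁L L).D c B)) (ψ₂ (ρ.p₂L.D c B))

/-- An Atiyah `(l, m)`-tensor `T` on `L_G` is multiplicative if
`f_T : DL_G ×_G ⋯ ×_G DL_G ×_G J¹L_G ×_G ⋯ ×_G J¹L_G → L_G` (`l` factors `DL_G`, `m` factors `J¹L_G`)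
is a groupoid map: `f_T(Θ₁ · Θ₂) = f_T(Θ₁) · f_T(Θ₂)` for all composable `Θ₁, Θ₂`. Here `Θ₁` and `Θ₂`
are over the arrows `g` and `h`, `c = (g, h)`, their components in `DL_G` are composable via the
`B i`, their jet components are `ψ₁` and `ψ₂`, and the jet components of the product are `χ`. -/
def IsMultiplicative {l m : ℕ} (T : (𝒢.LG L).AtiyahTensor l m) : Prop :=
  ∀ (c : P) (B : Fin l → (𝒢.LP L).D c) (ψ₁ : Fin m → (𝒢.LG L).J (𝒢.pr₁ c))
    (ψ₂ : Fin m → (𝒢.LG L).J (𝒢.pr₂ c)) (χ : Fin m → (𝒢.LG L).J (𝒢.mul c)),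
    (∀ j, ρ.JetComposable c (ψ₁ j) (ψ₂ j)) →
    (∀ j, ρ.JetMul c (ψ₁ j) (ψ₂ j) (χ j)) →
    T.toFun (𝒢.mul c) (fun i => (𝒢.mL L).D c (B i)) χ =
      ρ.mulLG c (T.toFun (𝒢.pr₁ c) (fun i => (𝒢.p₁L L).D c (B i)) ψ₁)
        (T.toFun (𝒢.pr₂ c) (fun i => ρ.p₂L.D c (B i)) ψ₂)

end LineAction
end LieGroupoid
end Groupoids
end

/-! A point `ε` of the homogenization over `x` is a linear isomorphism from `L_x` to `ℝ`, and above
it `p_T` and `p_{T*}` are linear isomorphisms onto `D_xL` and `J¹_xL`. An Atiyah tensor and its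
homogenization are therefore the same multilinear data read through these isomorphisms. What has to
be compared is the groupoid structures.

A line bundle map `φ` induces `φ̃(ε) = ε ∘ φ⁻¹` on homogenizations. Since `λ̃ ∘ φ̃` is the
homogenization of `φ^*λ`, the chain rule shows that `p_T` intertwines `dφ̃` with `Dφ`
(`pT_mfderiv_hgz`). All structure maps of `G̃`, including the two projections and the multiplication
on the composable pairs `(m^*L_G)^* ∖ 0`, are of the form `φ̃`, so `p_T` carries the tangent
groupoid of `G̃` to `DL_G`. On values, `⟨ε, ℓ + g.ℓ'⟩ = ⟨ε, ℓ⟩ + ⟨g⁻¹.ε, ℓ'⟩` (`form_mulLG`):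
pairing with the forms turns the product of `L_G` into addition of real numbers. Hence the
multiplicativity equation over a pair `k` is equivalent to the one over any point `c` above `k`
(`hgz_mul_iff`).

It remains to match the arguments allowed in the two equations. Products of jets match those of
covectors (`jetMul_pTstar_iff`) by the same computation. Composability (`jetComposable_pTstar_iff`)
is tested against products in `DL_G`, respectively in `TG̃`, so products in `DL_G` must also be
lifted back. There a compatibility of base points enters, because a derivation of `L_G` does not
remember a point of the fiber of `G̃ → G` (`tangentMul_of_DMul`). Finally, some `c` lies above every
`k`, and `p_T`, `p_{T*}` are onto, so every instance of one equation comes from an instance of the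
other. -/

section LineBundles

/-! ### Points, tangent vectors and covectors of the homogenization. -/

namespace LineBundle

variable {E : Type*} [NormedAddCommGroup E] [NormedSpace ℝ E]
  {H : Type*} [TopologicalSpace H] {I : ModelWithCorners ℝ E H}
  {M : Type*} [TopologicalSpace M] [ChartedSpace H M]

@[simp]
theorem castFib_symm (L : LineBundle I M) {x y : M} (h : x = y) :
    (L.castFib h).symm = L.castFib h.symm := by
  subst h; rfl

/-- Points of the homogenization are determined by their base points and linear forms. -/
theorem hgz_ext (L : LineBundle I M) {ε δ : L.Hgz} (h : L.hproj ε = L.hproj δ)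
    (hf : ∀ v, L.form ε v = L.form δ (L.castFib h v)) : ε = δ := by
  obtain ⟨⟨x, f⟩, hx⟩ := ε
  obtain ⟨⟨y, f'⟩, hy⟩ := δ
  change x = y at h
  subst h
  have : f = f' := ContinuousLinearMap.ext hf
  subst this
  rfl

/-- There is a nonzero linear form on each fiber. -/
theorem exists_hproj_eq (L : LineBundle I M) (x : M) : ∃ ε : L.Hgz, L.hproj ε = x := by
  set A := (trivializationAt ℝ L.Fib x).continuousLinearEquivAt ℝ x
    (FiberBundle.mem_baseSet_trivializationAt' x)
  refine ⟨⟨⟨x, (A : L.Fib x →L[ℝ] ℝ)⟩, fun h => ?_⟩, rfl⟩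
  have h1 : A (A.symm 1) = 0 := congrArg (fun f => f (A.symm 1)) h
  rw [A.apply_symm_apply] at h1
  exact one_ne_zero h1

/-- The vector bundle map `p_T`, on total spaces. -/
noncomputable def pTTot (L : LineBundle I M) (V : TangentBundle (I.prod 𝓘(ℝ, ℝ →L[ℝ] ℝ)) L.Hgz) :
    Σ x, L.D x :=
  ⟨L.hproj V.proj, L.pT V.proj V.2⟩

theorem pTTot_zero (L : LineBundle I M) (ε : L.Hgz) : L.pTTot ⟨ε, 0⟩ = ⟨L.hproj ε, 0⟩ :=
  congrArg (Sigma.mk (β := fun x => L.D x) _) (map_zero (L.pT ε))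

variable [FiniteDimensional ℝ E] [IsManifold I ∞ M] [T2Space M]

/-- The map `p_T` is injective only on each single tangent space: a derivation at `x` has one
preimage over every nonzero form on `L_x`. Hence the separate hypothesis on the base points. -/
theorem pTTot_inj (L : LineBundle I M) {V W : TangentBundle (I.prod 𝓘(ℝ, ℝ →L[ℝ] ℝ)) L.Hgz}
    (hp : V.proj = W.proj) (h : L.pTTot V = L.pTTot W) : V = W := by
  obtain ⟨ε, v⟩ := V
  obtain ⟨δ, w⟩ := W
  change ε = δ at hp
  subst hp
  have h1 : L.pT ε v = L.pT ε w := eq_of_heq (Sigma.mk.inj h).2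
  rw [(L.pT_bijective ε).1 h1]

/-- The preimage of `ψ` is `ε ∘ ψ ∘ p_T`, which is continuous because the tangent space is finite
dimensional. -/
theorem pTstar_surjective (L : LineBundle I M) (ε : L.Hgz) :
    Function.Surjective (L.pTstar ε) := by
  intro ψ
  have : FiniteDimensional ℝ (L.HT ε) :=
    inferInstanceAs (FiniteDimensional ℝ (E × (ℝ →L[ℝ] ℝ)))
  have : T2Space (L.HT ε) := inferInstanceAs (T2Space (E × (ℝ →L[ℝ] ℝ)))
  have : IsTopologicalAddGroup (L.HT ε) :=
    inferInstanceAs (IsTopologicalAddGroup (E × (ℝ →L[ℝ] ℝ)))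
  have : ContinuousSMul ℝ (L.HT ε) :=
    inferInstanceAs (ContinuousSMul ℝ (E × (ℝ →L[ℝ] ℝ)))
  refine ⟨LinearMap.toContinuousLinearMap
    ((L.form ε : L.Fib (L.hproj ε) →ₗ[ℝ] ℝ) ∘ₗ ψ ∘ₗ L.pT ε), ?_⟩
  ext Δ
  obtain ⟨v, rfl⟩ := (L.pT_bijective ε).2 Δ
  apply (L.bijective_form ε).1
  rw [L.form_pTstar_pT]
  rfl

end LineBundle

/-! ### Functoriality of the homogenization in line bundle maps. -/

namespace LineBundleMap

variable {E : Type*} [NormedAddCommGroup E] [NormedSpace ℝ E]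
  {H : Type*} [TopologicalSpace H] {I : ModelWithCorners ℝ E H}
  {M : Type*} [TopologicalSpace M] [ChartedSpace H M]
  {E' : Type*} [NormedAddCommGroup E'] [NormedSpace ℝ E']
  {H' : Type*} [TopologicalSpace H'] {I' : ModelWithCorners ℝ E' H'}
  {N : Type*} [TopologicalSpace N] [ChartedSpace H' N]
  {LN : LineBundle I' N} {L : LineBundle I M}

theorem form_hgz_fib (φ : LineBundleMap LN L) (ε : LN.Hgz) (v : LN.Fib (LN.hproj ε)) :
    L.form (φ.hgz ε) (φ.fib (LN.hproj ε) v) = LN.form ε v :=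
  congrArg (LN.form ε) ((φ.fib (LN.hproj ε)).symm_apply_apply v)

theorem pL_hgz (φ : LineBundleMap LN L) (ε : LN.Hgz) (r : ℝ) :
    L.pL (φ.hgz ε) r = φ.fib (LN.hproj ε) (LN.pL ε r) := by
  apply (L.bijective_form (φ.hgz ε)).1
  rw [L.form_pL]
  exact ((φ.form_hgz_fib ε _).trans (LN.form_pL ε r)).symm

/-- Over a fixed `y`, the map `ε ↦ ε ∘ φ_y⁻¹` is a bijection of nonzero forms. This lemma and
`exists_hgz_eq` identify the homogenization of `L_N` with the set of pairs of a point of `N` and a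
point of the homogenization of `L` over the same point of `M`. -/
theorem hgz_inj (φ : LineBundleMap LN L) {ε δ : LN.Hgz} (h : LN.hproj ε = LN.hproj δ)
    (hφ : φ.hgz ε = φ.hgz δ) : ε = δ := by
  obtain ⟨⟨x, f⟩, hx⟩ := ε
  obtain ⟨⟨y, f'⟩, hy⟩ := δ
  change x = y at h
  subst h
  have h1 := TotalSpace.mk_inj.1 (Subtype.mk.inj hφ)
  have : f = f' := by
    ext v
    have h2 := congrArg (fun F => F (φ.fib x v)) h1
    change f ((φ.fib x).symm (φ.fib x v)) = f' ((φ.fib x).symm (φ.fib x v)) at h2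
    rwa [ContinuousLinearEquiv.symm_apply_apply] at h2
  subst this
  rfl

theorem exists_hgz_eq (φ : LineBundleMap LN L) {y : N} {ε : L.Hgz} (h : φ.base y = L.hproj ε) :
    ∃ δ : LN.Hgz, LN.hproj δ = y ∧ φ.hgz δ = ε := by
  obtain ⟨⟨x, f⟩, hx⟩ := ε
  change φ.base y = x at h
  subst h
  -- The lift of the form `f` is its transpose image `f ∘ φ_y`; it is nonzero because `φ_y` is onto.
  refine ⟨⟨⟨y, ContinuousLinearMap.comp f (φ.fib y : LN.Fib y →L[ℝ] L.Fib (φ.base y))⟩,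
    fun h => hx ?_⟩, rfl, ?_⟩
  · ext v
    have h' := congrArg (fun F => F ((φ.fib y).symm v)) h
    change f (φ.fib y ((φ.fib y).symm v)) = 0 at h'
    rwa [ContinuousLinearEquiv.apply_symm_apply] at h'
  · refine L.hgz_ext rfl fun v => ?_
    exact congrArg f ((φ.fib y).apply_symm_apply v)

section

variable [IsManifold I' ∞ N] [FiniteDimensional ℝ E] [IsManifold I ∞ M] [T2Space M]

/-- In a trivialization of `L*`, the fiber coordinate of `φ̃(δ)` is its value on the local frame `s`
of `L`, namely `⟨δ, φ^*s⟩`. This is the homogenization of the smooth section `φ^*s`, hence smooth in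
`δ`. -/
theorem contMDiff_hgz (φ : LineBundleMap LN L) :
    ContMDiff (I'.prod 𝓘(ℝ, ℝ →L[ℝ] ℝ)) (I.prod 𝓘(ℝ, ℝ →L[ℝ] ℝ)) ∞ φ.hgz := by
  rw [← ContMDiff.subtypeVal_comp_iff]
  intro ε
  have hb : ContMDiff (I'.prod 𝓘(ℝ, ℝ →L[ℝ] ℝ)) I ∞ (fun δ => φ.base (LN.hproj δ)) :=
    φ.base.contMDiff.comp LN.contMDiff_hproj
  -- The section `s` is global, so that it can be pulled back, but near the base point it is the
  -- frame of the trivialization.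
  obtain ⟨s, -, -, hs, -⟩ := L.exists_frame (φ.base (LN.hproj ε))
  refine (contMDiffAt_hom_bundle (E₁ := L.Fib) (E₂ := Trivial M ℝ) _).2 ⟨hb ε, ?_⟩
  have h1 : ContMDiffAt (I'.prod 𝓘(ℝ, ℝ →L[ℝ] ℝ)) 𝓘(ℝ, ℝ →L[ℝ] ℝ) ∞
      (fun δ => ContinuousLinearMap.toSpanSingleton ℝ (ContinuousLinearMap.id ℝ ℝ)
        (LN.hsec (φ.pullSec s) δ)) ε :=
    (ContinuousLinearMap.contMDiff _).contMDiffAt.comp ε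
      (LN.contMDiff_hsec (φ.pullSec s)).contMDiffAt
  refine h1.congr_of_eventuallyEq ?_
  have hc := hb.continuous.continuousAt (x := ε)
  filter_upwards [hc.eventually hs, hc.preimage_mem_nhds
    ((trivializationAt ℝ L.Fib (φ.base (LN.hproj ε))).open_baseSet.mem_nhds
      (FiberBundle.mem_baseSet_trivializationAt' _))] with δ hδ hδ'
  have h2 : (trivializationAt ℝ L.Fib (φ.base (LN.hproj ε))).symmL ℝ (φ.base (LN.hproj δ)) 1 =
      s (φ.base (LN.hproj δ)) := by
    rw [Bundle.Trivialization.symmL_apply _ hδ', hδ]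
  ext
  have h3 : L.form (φ.hgz δ) ((trivializationAt ℝ L.Fib (φ.base (LN.hproj ε))).symmL ℝ
      (φ.base (LN.hproj δ)) 1) = LN.hsec (φ.pullSec s) δ := congrArg (L.form (φ.hgz δ)) h2
  refine Eq.trans ?_ (h3.trans (mul_one _).symm)
  change (trivializationAt ℝ (Trivial M ℝ) (φ.base (LN.hproj ε))).continuousLinearMapAt ℝ
    (φ.base (LN.hproj δ)) (L.form (φ.hgz δ) _) = _
  simp
  rfl

theorem mdifferentiableAt_hgz (φ : LineBundleMap LN L) (ε : LN.Hgz) :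
    MDifferentiableAt (I'.prod 𝓘(ℝ, ℝ →L[ℝ] ℝ)) (I.prod 𝓘(ℝ, ℝ →L[ℝ] ℝ)) φ.hgz ε :=
  φ.contMDiff_hgz.mdifferentiable (by simp) ε

/-- Naturality of `p_T` with respect to line bundle maps. -/
theorem pT_mfderiv_hgz (φ : LineBundleMap LN L) (ε : LN.Hgz) (v : LN.HT ε) :
    L.pT (φ.hgz ε)
        (mfderiv (I'.prod 𝓘(ℝ, ℝ →L[ℝ] ℝ)) (I.prod 𝓘(ℝ, ℝ →L[ℝ] ℝ)) φ.hgz ε v) =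
      φ.D (LN.hproj ε) (LN.pT ε v) := by
  ext lam
  -- The function on the left is definitionally the homogenization of `φ^*λ`, so its derivative
  -- along `v` computes `p_T(v)(φ^*λ)`.
  have h : mvfderiv (I'.prod 𝓘(ℝ, ℝ →L[ℝ] ℝ)) (L.hsec lam ∘ φ.hgz) ε v =
      mvfderiv (I.prod 𝓘(ℝ, ℝ →L[ℝ] ℝ)) (L.hsec lam) (φ.hgz ε)
        (mfderiv (I'.prod 𝓘(ℝ, ℝ →L[ℝ] ℝ)) (I.prod 𝓘(ℝ, ℝ →L[ℝ] ℝ)) φ.hgz ε v) :=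
    mvfderiv_comp_apply ε (L.mdiff_hsec lam _) (φ.mdifferentiableAt_hgz ε) v
  exact (congrArg (L.pL (φ.hgz ε)) h.symm).trans (φ.pL_hgz ε _)

theorem DTot_pTTot (φ : LineBundleMap LN L)
    (V : TangentBundle (I'.prod 𝓘(ℝ, ℝ →L[ℝ] ℝ)) LN.Hgz) :
    φ.DTot (LN.pTTot V) = L.pTTot
      (tangentMap (I'.prod 𝓘(ℝ, ℝ →L[ℝ] ℝ)) (I.prod 𝓘(ℝ, ℝ →L[ℝ] ℝ)) φ.hgz V) :=
  congrArg (Sigma.mk (β := fun x => L.D x) (φ.base (LN.hproj V.proj)))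
    (φ.pT_mfderiv_hgz V.proj V.2).symm

end

end LineBundleMap
end LineBundles

/-! ### The groupoid `G̃` and its comparison with `L_G`, `DL_G` and `J¹L_G`. -/

namespace LieGroupoid

section

variable {EM : Type*} [NormedAddCommGroup EM] [NormedSpace ℝ EM]
  {HM : Type*} [TopologicalSpace HM] {IM : ModelWithCorners ℝ EM HM}
  {M : Type*} [TopologicalSpace M] [ChartedSpace HM M]
  {EG : Type*} [NormedAddCommGroup EG] [NormedSpace ℝ EG]
  {HG : Type*} [TopologicalSpace HG] {IG : ModelWithCorners ℝ EG HG}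
  {G : Type*} [TopologicalSpace G] [ChartedSpace HG G]
  {EP : Type*} [NormedAddCommGroup EP] [NormedSpace ℝ EP]
  {HP : Type*} [TopologicalSpace HP] {IP : ModelWithCorners ℝ EP HP}
  {P : Type*} [TopologicalSpace P] [ChartedSpace HP P]

/-- The composable pairs embed in `G × G`. The Hausdorff property is what makes `p_T` bijective over
them, through bump functions. -/
theorem t2Space_pairs [T2Space G] (𝒢 : LieGroupoid IM M IG G IP P) : T2Space P :=
  𝒢.pair_embedding.isEmbedding.t2Space

namespace LineAction

variable {𝒢 : LieGroupoid IM M IG G IP P} {L : LineBundle IM M} (ρ : LineAction 𝒢 L)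

/-! ### The structure maps of the homogenization -/

/-- For `c = ((g, h), ε)`, both sides carry the form `g⁻¹.ε`; they differ by a transport between
equal fibers that cancels. -/
theorem hgz_src_pr₁ (c : (𝒢.LP L).Hgz) : ρ.hgz.src (ρ.hgz.pr₁ c) = ρ.hgz.tgt (ρ.hgz.pr₂ c) :=
  L.hgz_ext (𝒢.src_pr₁ _) fun v => congrArg
    (fun z => (𝒢.LP L).form c ((L.castFib (𝒢.tgt_mul ((𝒢.LP L).hproj c))).symm
      (ρ.act (𝒢.pr₁ ((𝒢.LP L).hproj c)) z)))
    ((L.castFib (𝒢.src_pr₁ ((𝒢.LP L).hproj c))).symm_apply_apply v).symm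

theorem hgz_tgt_mul (c : (𝒢.LP L).Hgz) : ρ.hgz.tgt (ρ.hgz.mul c) = ρ.hgz.tgt (ρ.hgz.pr₁ c) :=
  L.hgz_ext (𝒢.tgt_mul _) fun v => congrArg ((𝒢.LP L).form c)
    ((L.castFib (𝒢.tgt_mul ((𝒢.LP L).hproj c))).symm_apply_apply v).symm

theorem hgz_tgt_one (x : L.Hgz) : ρ.hgz.tgt (ρ.hgz.one x) = x :=
  L.hgz_ext (𝒢.tgt_one _) fun v => congrArg (fun A : L.Fib (𝒢.tgt (𝒢.one (L.hproj x))) ≃L[ℝ]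
    L.Fib (L.hproj x) => L.form x (A v)) (L.castFib_symm (𝒢.tgt_one (L.hproj x)).symm)

theorem castFib_act_one (x : M) (ℓ : L.Fib (𝒢.src (𝒢.one x))) :
    (L.castFib (𝒢.tgt_one x).symm).symm (ρ.act (𝒢.one x) ℓ) = L.castFib (𝒢.src_one x) ℓ := by
  rw [LineBundle.castFib_symm]
  exact TotalSpace.mk_inj.1
    ((L.mk_castFib _ _).trans ((ρ.act_one x ℓ).trans (L.mk_castFib (𝒢.src_one x) ℓ).symm))

theorem hgz_src_one (x : L.Hgz) : ρ.hgz.src (ρ.hgz.one x) = x :=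
  L.hgz_ext (𝒢.src_one _) fun v => congrArg (L.form x) (ρ.castFib_act_one (L.hproj x) v)

theorem hgz_tgt_inv (g : (𝒢.LG L).Hgz) : ρ.hgz.tgt (ρ.hgz.inv g) = ρ.hgz.src g :=
  L.hgz_ext (𝒢.tgt_inv _) fun v => congrArg
    (fun A : L.Fib (𝒢.tgt (𝒢.inv ((𝒢.LG L).hproj g))) ≃L[ℝ] L.Fib (𝒢.src ((𝒢.LG L).hproj g)) =>
      (𝒢.LG L).form g (ρ.act ((𝒢.LG L).hproj g) (A v)))
    (L.castFib_symm (𝒢.tgt_inv ((𝒢.LG L).hproj g)).symm)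

/-- Written in the fiber of `m^*L_G`, the product is a plain sum: the identifications of `m^*L_G`
with the pullbacks of `L_G` under the two projections absorb the action of `g`. -/
theorem mulLG_eq (c : P) (ℓ : (𝒢.LG L).Fib (𝒢.pr₁ c)) (ℓ' : (𝒢.LG L).Fib (𝒢.pr₂ c)) :
    ρ.mulLG c ℓ ℓ' =
      (((𝒢.p₁L L).fib c).symm ℓ + (ρ.p₂L.fib c).symm ℓ' : (𝒢.LP L).Fib c) := by
  change L.castFib (𝒢.tgt_mul c).symm ((show L.Fib (𝒢.tgt (𝒢.pr₁ c)) from ℓ) +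
    ρ.act (𝒢.pr₁ c) (L.castFib (𝒢.src_pr₁ c).symm ℓ')) =
    (L.castFib (𝒢.tgt_mul c)).symm ℓ + (L.castFib (𝒢.tgt_mul c)).symm
      (ρ.act (𝒢.pr₁ c) ((L.castFib (𝒢.src_pr₁ c)).symm ℓ'))
  rw [LineBundle.castFib_symm, LineBundle.castFib_symm, map_add]

/-- The homogenization turns the multiplication of the LB-groupoid into addition. -/
theorem form_mulLG (c : (𝒢.LP L).Hgz) (ℓ : (𝒢.LG L).Fib (𝒢.pr₁ ((𝒢.LP L).hproj c)))
    (ℓ' : (𝒢.LG L).Fib (𝒢.pr₂ ((𝒢.LP L).hproj c))) :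
    (𝒢.LG L).form (ρ.hgz.mul c) (ρ.mulLG ((𝒢.LP L).hproj c) ℓ ℓ') =
      (𝒢.LG L).form (ρ.hgz.pr₁ c) ℓ + (𝒢.LG L).form (ρ.hgz.pr₂ c) ℓ' :=
  (congrArg ((𝒢.LP L).form c) (ρ.mulLG_eq _ ℓ ℓ')).trans (map_add ((𝒢.LP L).form c) _ _)

theorem p₂L_symm_castFib_act_symm (c : P) (ℓ : (𝒢.LG L).Fib (𝒢.pr₁ c)) :
    (ρ.p₂L.fib c).symm (L.castFib (𝒢.src_pr₁ c) (-(ρ.act (𝒢.pr₁ c)).symm ℓ)) =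
      -((𝒢.p₁L L).fib c).symm ℓ := by
  change (L.castFib (𝒢.tgt_mul c)).symm (ρ.act (𝒢.pr₁ c) ((L.castFib (𝒢.src_pr₁ c)).symm
    (L.castFib (𝒢.src_pr₁ c) (-(ρ.act (𝒢.pr₁ c)).symm ℓ)))) = -(L.castFib (𝒢.tgt_mul c)).symm ℓ
  rw [ContinuousLinearEquiv.symm_apply_apply, map_neg, map_neg]
  exact congrArg (fun z => -(L.castFib (𝒢.tgt_mul c)).symm z)
    ((ρ.act (𝒢.pr₁ c)).apply_symm_apply ℓ)

/-- This turns the source formula for jets, with its factor `-g⁻¹`, into the one for covectors, with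
only the sign: the form at the second arrow is the form at the first moved by `g⁻¹`, which cancels
the action. -/
theorem form_castFib_act_symm (c : (𝒢.LP L).Hgz)
    (ℓ : (𝒢.LG L).Fib (𝒢.pr₁ ((𝒢.LP L).hproj c))) :
    (𝒢.LG L).form (ρ.hgz.pr₂ c) (L.castFib (𝒢.src_pr₁ ((𝒢.LP L).hproj c))
      (-(ρ.act (𝒢.pr₁ ((𝒢.LP L).hproj c))).symm ℓ)) = -(𝒢.LG L).form (ρ.hgz.pr₁ c) ℓ :=
  (congrArg ((𝒢.LP L).form c) (ρ.p₂L_symm_castFib_act_symm _ ℓ)).trans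
    (map_neg ((𝒢.LP L).form c) _)

/-! ### The derivation groupoid and the tangent groupoid of the homogenization -/

variable [IsManifold IG ∞ G]

section

variable [FiniteDimensional ℝ EM] [IsManifold IM ∞ M] [T2Space M]

/-- By naturality, `p_T` intertwines the differential of the source of `G̃` with the source of
`DL_G`; being injective, it matches their kernels. -/
theorem core_iff_Alg (x : L.Hgz) (a : (𝒢.LG L).HT (ρ.hgz.one x)) :
    (𝒢.LG L).pT (ρ.hgz.one x) a ∈ ρ.core (L.hproj x) ↔
      a ∈ ρ.hgz.Alg (IM.prod 𝓘(ℝ, ℝ →L[ℝ] ℝ)) (IG.prod 𝓘(ℝ, ℝ →L[ℝ] ℝ)) x := by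
  have h := ρ.sL.pT_mfderiv_hgz (ρ.hgz.one x) a
  constructor
  · intro ha
    have ha' : ρ.sL.D ((𝒢.LG L).hproj (ρ.hgz.one x)) ((𝒢.LG L).pT (ρ.hgz.one x) a) = 0 := ha
    rw [ha'] at h
    exact (L.pT_bijective _).1 (h.trans (map_zero _).symm)
  · intro ha
    have ha' : mfderiv (IG.prod 𝓘(ℝ, ℝ →L[ℝ] ℝ)) (IM.prod 𝓘(ℝ, ℝ →L[ℝ] ℝ)) ρ.sL.hgz
      (ρ.hgz.one x) a = 0 := ha
    rw [ha'] at h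
    exact h.symm.trans (map_zero _)

end

variable [FiniteDimensional ℝ EG] [T2Space G] [IsManifold IP ∞ P]

theorem DMul_pTTot {V W U : TangentBundle (IG.prod 𝓘(ℝ, ℝ →L[ℝ] ℝ)) (𝒢.LG L).Hgz}
    (h : ρ.hgz.TangentMul (IG.prod 𝓘(ℝ, ℝ →L[ℝ] ℝ)) (IP.prod 𝓘(ℝ, ℝ →L[ℝ] ℝ)) V W U) :
    ρ.DMul ((𝒢.LG L).pTTot V) ((𝒢.LG L).pTTot W) ((𝒢.LG L).pTTot U) := by
  obtain ⟨ξ, rfl, rfl, rfl⟩ := h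
  exact ⟨(𝒢.LP L).pTTot ξ, (𝒢.p₁L L).DTot_pTTot ξ, ρ.p₂L.DTot_pTTot ξ, (𝒢.mL L).DTot_pTTot ξ⟩

/-- The multiplicativity equation of an Atiyah tensor, read on the homogenization. -/
theorem hgz_mul_iff {l m : ℕ} (T : (𝒢.LG L).AtiyahTensor l m) (c : (𝒢.LP L).Hgz)
    (ξ : Fin l → (𝒢.LP L).HT c) (η : Fin m → ((𝒢.LG L).HT (ρ.hgz.pr₁ c) →L[ℝ] ℝ))
    (θ : Fin m → ((𝒢.LG L).HT (ρ.hgz.pr₂ c) →L[ℝ] ℝ))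
    (κ : Fin m → ((𝒢.LG L).HT (ρ.hgz.mul c) →L[ℝ] ℝ)) :
    (T.toFun (𝒢.mul ((𝒢.LP L).hproj c))
        (fun i => (𝒢.mL L).D ((𝒢.LP L).hproj c) ((𝒢.LP L).pT c (ξ i)))
        (fun j => (𝒢.LG L).pTstar (ρ.hgz.mul c) (κ j)) =
      ρ.mulLG ((𝒢.LP L).hproj c)
        (T.toFun (𝒢.pr₁ ((𝒢.LP L).hproj c))
          (fun i => (𝒢.p₁L L).D ((𝒢.LP L).hproj c) ((𝒢.LP L).pT c (ξ i)))
          (fun j => (𝒢.LG L).pTstar (ρ.hgz.pr₁ c) (η j)))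
        (T.toFun (𝒢.pr₂ ((𝒢.LP L).hproj c))
          (fun i => ρ.p₂L.D ((𝒢.LP L).hproj c) ((𝒢.LP L).pT c (ξ i)))
          (fun j => (𝒢.LG L).pTstar (ρ.hgz.pr₂ c) (θ j)))) ↔
      T.hgz (ρ.hgz.mul c) (fun i => mfderiv (IP.prod 𝓘(ℝ, ℝ →L[ℝ] ℝ))
          (IG.prod 𝓘(ℝ, ℝ →L[ℝ] ℝ)) ρ.hgz.mul c (ξ i)) κ =
        T.hgz (ρ.hgz.pr₁ c) (fun i => mfderiv (IP.prod 𝓘(ℝ, ℝ →L[ℝ] ℝ))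
          (IG.prod 𝓘(ℝ, ℝ →L[ℝ] ℝ)) ρ.hgz.pr₁ c (ξ i)) η +
        T.hgz (ρ.hgz.pr₂ c) (fun i => mfderiv (IP.prod 𝓘(ℝ, ℝ →L[ℝ] ℝ))
          (IG.prod 𝓘(ℝ, ℝ →L[ℝ] ℝ)) ρ.hgz.pr₂ c (ξ i)) θ := by
  -- Naturality of `p_T` for the two projections and the multiplication, applied to all the tangent
  -- arguments at once.
  have e₁ := funext fun i => (𝒢.p₁L L).pT_mfderiv_hgz c (ξ i)
  have e₂ := funext fun i => ρ.p₂L.pT_mfderiv_hgz c (ξ i)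
  have e₃ := funext fun i => (𝒢.mL L).pT_mfderiv_hgz c (ξ i)
  have t₁ := congrArg (fun Δ => (𝒢.LG L).form (ρ.hgz.pr₁ c)
    (T.toFun ((𝒢.LG L).hproj (ρ.hgz.pr₁ c)) Δ
      (fun j => (𝒢.LG L).pTstar (ρ.hgz.pr₁ c) (η j)))) e₁
  have t₂ := congrArg (fun Δ => (𝒢.LG L).form (ρ.hgz.pr₂ c)
    (T.toFun ((𝒢.LG L).hproj (ρ.hgz.pr₂ c)) Δ
      (fun j => (𝒢.LG L).pTstar (ρ.hgz.pr₂ c) (θ j)))) e₂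
  have t₃ := congrArg (fun Δ => (𝒢.LG L).form (ρ.hgz.mul c)
    (T.toFun ((𝒢.LG L).hproj (ρ.hgz.mul c)) Δ
      (fun j => (𝒢.LG L).pTstar (ρ.hgz.mul c) (κ j)))) e₃
  -- An equation in a fiber of `L_G` may be tested by the form at the product, which is injective
  -- and turns the right-hand side into a sum.
  refine ((𝒢.LG L).bijective_form (ρ.hgz.mul c)).1.eq_iff.symm.trans ?_
  refine Iff.trans (Eq.congr t₃.symm ((ρ.form_mulLG c _ _).trans
    (congrArg₂ (· + ·) t₁.symm t₂.symm))) Iff.rfl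

/-! ### Lifting products, and the comparison of jets with covectors. -/

variable [FiniteDimensional ℝ EP]

/-- Products in `DL_G` lift to the tangent groupoid of the homogenization, over all base points
for which the product makes sense. -/
theorem tangentMul_of_DMul {V W U : TangentBundle (IG.prod 𝓘(ℝ, ℝ →L[ℝ] ℝ)) (𝒢.LG L).Hgz}
    (hVW : ρ.hgz.src V.proj = ρ.hgz.tgt W.proj) (hVU : ρ.hgz.tgt U.proj = ρ.hgz.tgt V.proj)
    (h : ρ.DMul ((𝒢.LG L).pTTot V) ((𝒢.LG L).pTTot W) ((𝒢.LG L).pTTot U)) :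
    ρ.hgz.TangentMul (IG.prod 𝓘(ℝ, ℝ →L[ℝ] ℝ)) (IP.prod 𝓘(ℝ, ℝ →L[ℝ] ℝ)) V W U := by
  have : T2Space P := 𝒢.t2Space_pairs
  obtain ⟨⟨k, B⟩, h₁, h₂, h₃⟩ := h
  -- The pair `k` in `P` is prescribed, but the form above it is free; it is fixed by requiring the
  -- first projection to be the base point of `V`.
  obtain ⟨c, rfl, hc⟩ := (𝒢.p₁L L).exists_hgz_eq (y := k) (ε := V.proj) (congrArg Sigma.fst h₁)
  obtain ⟨ξ, rfl⟩ := ((𝒢.LP L).pT_bijective c).2 B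
  have hc₁ : ρ.hgz.pr₁ c = V.proj := hc
  -- An arrow of `G̃` is determined by its arrow in `G` and its target. The arrows of `G` agree
  -- because the products in `DL_G` do, and the targets agree by hypothesis; the product is treated
  -- in the same way.
  have hc₂ : ρ.hgz.pr₂ c = W.proj := by
    refine (𝒢.tL L).hgz_inj (congrArg Sigma.fst h₂) ?_
    change ρ.hgz.tgt (ρ.hgz.pr₂ c) = ρ.hgz.tgt W.proj
    rw [← hVW, ← hc₁, hgz_src_pr₁]
  have hc₃ : ρ.hgz.mul c = U.proj := by
    refine (𝒢.tL L).hgz_inj (congrArg Sigma.fst h₃) ?_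
    change ρ.hgz.tgt (ρ.hgz.mul c) = ρ.hgz.tgt U.proj
    rw [hVU, ← hc₁, hgz_tgt_mul]
  exact ⟨⟨c, ξ⟩,
    (𝒢.LG L).pTTot_inj hc₁ (((𝒢.p₁L L).DTot_pTTot ⟨c, ξ⟩).symm.trans h₁),
    (𝒢.LG L).pTTot_inj hc₂ ((ρ.p₂L.DTot_pTTot ⟨c, ξ⟩).symm.trans h₂),
    (𝒢.LG L).pTTot_inj hc₃ (((𝒢.mL L).DTot_pTTot ⟨c, ξ⟩).symm.trans h₃)⟩

/-- Pairing the jet identity at `B = p_T(ξ)` with the form at the product gives the covector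
identity at `ξ`. Nothing is lost, since the form is injective and every `B` is such an image. -/
theorem jetMul_pTstar_iff (c : (𝒢.LP L).Hgz)
    (η : (𝒢.LG L).HT (ρ.hgz.pr₁ c) →L[ℝ] ℝ) (θ : (𝒢.LG L).HT (ρ.hgz.pr₂ c) →L[ℝ] ℝ)
    (κ : (𝒢.LG L).HT (ρ.hgz.mul c) →L[ℝ] ℝ) :
    ρ.JetMul ((𝒢.LP L).hproj c) ((𝒢.LG L).pTstar (ρ.hgz.pr₁ c) η)
        ((𝒢.LG L).pTstar (ρ.hgz.pr₂ c) θ) ((𝒢.LG L).pTstar (ρ.hgz.mul c) κ) ↔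
      ρ.hgz.CotangentMul (IG.prod 𝓘(ℝ, ℝ →L[ℝ] ℝ)) (IP.prod 𝓘(ℝ, ℝ →L[ℝ] ℝ)) c η θ κ := by
  have : T2Space P := 𝒢.t2Space_pairs
  have key : ∀ ξ : (𝒢.LP L).HT c,
      (𝒢.LG L).form (ρ.hgz.mul c) ((𝒢.LG L).pTstar (ρ.hgz.mul c) κ
        ((𝒢.mL L).D ((𝒢.LP L).hproj c) ((𝒢.LP L).pT c ξ))) =
        κ (mfderiv (IP.prod 𝓘(ℝ, ℝ →L[ℝ] ℝ)) (IG.prod 𝓘(ℝ, ℝ →L[ℝ] ℝ)) ρ.hgz.mul c ξ) ∧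
      (𝒢.LG L).form (ρ.hgz.mul c) (ρ.mulLG ((𝒢.LP L).hproj c)
        ((𝒢.LG L).pTstar (ρ.hgz.pr₁ c) η
          ((𝒢.p₁L L).D ((𝒢.LP L).hproj c) ((𝒢.LP L).pT c ξ)))
        ((𝒢.LG L).pTstar (ρ.hgz.pr₂ c) θ (ρ.p₂L.D ((𝒢.LP L).hproj c) ((𝒢.LP L).pT c ξ)))) =
        η (mfderiv (IP.prod 𝓘(ℝ, ℝ →L[ℝ] ℝ)) (IG.prod 𝓘(ℝ, ℝ →L[ℝ] ℝ)) ρ.hgz.pr₁ c ξ) +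
        θ (mfderiv (IP.prod 𝓘(ℝ, ℝ →L[ℝ] ℝ)) (IG.prod 𝓘(ℝ, ℝ →L[ℝ] ℝ)) ρ.hgz.pr₂ c ξ) := by
    intro ξ
    have h₁ := (𝒢.LG L).form_pTstar_pT (ρ.hgz.pr₁ c) η
      (mfderiv (IP.prod 𝓘(ℝ, ℝ →L[ℝ] ℝ)) (IG.prod 𝓘(ℝ, ℝ →L[ℝ] ℝ)) ρ.hgz.pr₁ c ξ)
    have h₂ := (𝒢.LG L).form_pTstar_pT (ρ.hgz.pr₂ c) θ
      (mfderiv (IP.prod 𝓘(ℝ, ℝ →L[ℝ] ℝ)) (IG.prod 𝓘(ℝ, ℝ →L[ℝ] ℝ)) ρ.hgz.pr₂ c ξ)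
    have h₃ := (𝒢.LG L).form_pTstar_pT (ρ.hgz.mul c) κ
      (mfderiv (IP.prod 𝓘(ℝ, ℝ →L[ℝ] ℝ)) (IG.prod 𝓘(ℝ, ℝ →L[ℝ] ℝ)) ρ.hgz.mul c ξ)
    have e₁ := (𝒢.p₁L L).pT_mfderiv_hgz c ξ
    have e₂ := ρ.p₂L.pT_mfderiv_hgz c ξ
    have e₃ := (𝒢.mL L).pT_mfderiv_hgz c ξ
    refine ⟨Eq.trans ?_ h₃, (ρ.form_mulLG c _ _).trans (congrArg₂ (· + ·) ?_ ?_)⟩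
    · exact congrArg (fun Δ => (𝒢.LG L).form (ρ.hgz.mul c)
        ((𝒢.LG L).pTstar (ρ.hgz.mul c) κ Δ)) e₃.symm
    · exact (congrArg (fun Δ => (𝒢.LG L).form (ρ.hgz.pr₁ c)
        ((𝒢.LG L).pTstar (ρ.hgz.pr₁ c) η Δ)) e₁.symm).trans h₁
    · exact (congrArg (fun Δ => (𝒢.LG L).form (ρ.hgz.pr₂ c)
        ((𝒢.LG L).pTstar (ρ.hgz.pr₂ c) θ Δ)) e₂.symm).trans h₂
  constructor
  · intro h ξ
    exact (key ξ).1.symm.trans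
      ((congrArg ((𝒢.LG L).form (ρ.hgz.mul c)) (h ((𝒢.LP L).pT c ξ))).trans (key ξ).2)
  · intro h B
    obtain ⟨ξ, rfl⟩ := ((𝒢.LP L).pT_bijective c).2 B
    exact ((𝒢.LG L).bijective_form (ρ.hgz.mul c)).1
      ((key ξ).1.trans ((h ξ).trans (key ξ).2.symm))

variable [FiniteDimensional ℝ EM] [IsManifold IM ∞ M] [T2Space M]

/-- Both conditions are tested on triples `(a, u, w)` subject to two product relations. The map
`p_T` gives a bijection between the triples, respects the relations in both directions, and `key`
matches the tested equations. -/
theorem jetComposable_pTstar_iff (c : (𝒢.LP L).Hgz)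
    (η : (𝒢.LG L).HT (ρ.hgz.pr₁ c) →L[ℝ] ℝ) (θ : (𝒢.LG L).HT (ρ.hgz.pr₂ c) →L[ℝ] ℝ) :
    ρ.JetComposable ((𝒢.LP L).hproj c) ((𝒢.LG L).pTstar (ρ.hgz.pr₁ c) η)
        ((𝒢.LG L).pTstar (ρ.hgz.pr₂ c) θ) ↔
      ρ.hgz.CotangentComposable (IM.prod 𝓘(ℝ, ℝ →L[ℝ] ℝ)) (IG.prod 𝓘(ℝ, ℝ →L[ℝ] ℝ))
        (IP.prod 𝓘(ℝ, ℝ →L[ℝ] ℝ)) c η θ := by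
  set x := ρ.hgz.src (ρ.hgz.pr₁ c) with hx
  have key : ∀ u w, L.castFib (𝒢.src_pr₁ ((𝒢.LP L).hproj c))
      (-(ρ.act (𝒢.pr₁ ((𝒢.LP L).hproj c))).symm ((𝒢.LG L).pTstar (ρ.hgz.pr₁ c) η
        ((𝒢.LG L).pT (ρ.hgz.pr₁ c) u))) =
      (𝒢.LG L).pTstar (ρ.hgz.pr₂ c) θ ((𝒢.LG L).pT (ρ.hgz.pr₂ c) w) ↔ -η u = θ w := by
    intro u w
    have h₁ := ρ.form_castFib_act_symm c ((𝒢.LG L).pTstar (ρ.hgz.pr₁ c) η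
        ((𝒢.LG L).pT (ρ.hgz.pr₁ c) u))
    have h₂ := (𝒢.LG L).form_pTstar_pT (ρ.hgz.pr₂ c) θ w
    have h₃ := (𝒢.LG L).form_pTstar_pT (ρ.hgz.pr₁ c) η u
    have h₄ := h₁.trans (congrArg Neg.neg h₃)
    constructor
    · intro h
      exact h₄.symm.trans ((congrArg ((𝒢.LG L).form (ρ.hgz.pr₂ c)) h).trans h₂)
    · intro h
      exact ((𝒢.LG L).bijective_form (ρ.hgz.pr₂ c)).1 (h₄.trans (h.trans h₂.symm))
  have hone := ρ.hgz_src_one x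
  constructor
  · intro h a ha u w hu hw
    refine (key u w).1 (h _ ((ρ.core_iff_Alg x a).2 ha) _ _ ?_ ?_)
    · have := ρ.DMul_pTTot hu
      rw [LineBundle.pTTot_zero] at this
      -- The tangent of the inversion of `G̃` corresponds under `p_T` to the inversion of `DL_G`.
      exact (ρ.iL.DTot_pTTot ⟨_, a⟩) ▸ this
    · have := ρ.DMul_pTTot hw
      rw [LineBundle.pTTot_zero] at this
      exact this
  · intro h a ha u w hu hw
    -- The derivations are lifted at the unit over `x = s(pr₁ c)` and at the two components of `c`.
    -- With these base points the sources and targets fit, as `tangentMul_of_DMul` requires.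
    obtain ⟨a, rfl⟩ := ((𝒢.LG L).pT_bijective (ρ.hgz.one x)).2 a
    obtain ⟨u, rfl⟩ := ((𝒢.LG L).pT_bijective (ρ.hgz.pr₁ c)).2 u
    obtain ⟨w, rfl⟩ := ((𝒢.LG L).pT_bijective (ρ.hgz.pr₂ c)).2 w
    refine (key u w).2 (h a ((ρ.core_iff_Alg x a).1 ha) u w ?_ ?_)
    · refine ρ.tangentMul_of_DMul ?_ rfl ?_
      · exact ((ρ.hgz_tgt_inv _).trans hone).symm
      · rw [LineBundle.pTTot_zero]
        exact (ρ.iL.DTot_pTTot ⟨_, a⟩) ▸ hu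
    · refine ρ.tangentMul_of_DMul ?_ ?_ ?_
      · exact hone.trans (ρ.hgz_src_pr₁ c)
      · exact (ρ.hgz_src_pr₁ c).symm.trans (ρ.hgz_tgt_one x).symm
      · rw [LineBundle.pTTot_zero]
        exact hw

/-! ### The equivalence of the two notions of multiplicativity. -/

theorem isMultiplicative_iff_hgz {l m : ℕ} (T : (𝒢.LG L).AtiyahTensor l m) :
    ρ.IsMultiplicative T ↔
      ρ.hgz.IsMultiplicativeTensor (IM.prod 𝓘(ℝ, ℝ →L[ℝ] ℝ))
        (IG.prod 𝓘(ℝ, ℝ →L[ℝ] ℝ)) (IP.prod 𝓘(ℝ, ℝ →L[ℝ] ℝ)) T.hgz := by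
  have : T2Space P := 𝒢.t2Space_pairs
  constructor
  · intro h c ξ η θ κ hc hm
    exact (ρ.hgz_mul_iff T c ξ η θ κ).1 (h _ _ _ _ _
      (fun j => (ρ.jetComposable_pTstar_iff c (η j) (θ j)).2 (hc j))
      (fun j => (ρ.jetMul_pTstar_iff c (η j) (θ j) (κ j)).2 (hm j)))
  · intro h k B ψ₁ ψ₂ χ hc hm
    -- Any nonzero form over `k` will do; once it is chosen, all derivations and jets lift uniquely
    -- or at least surjectively to vectors and covectors at `c` and its images.
    obtain ⟨c, rfl⟩ := (𝒢.LP L).exists_hproj_eq k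
    choose ξ hξ using fun i => ((𝒢.LP L).pT_bijective c).2 (B i)
    choose η hη using fun j => (𝒢.LG L).pTstar_surjective (ρ.hgz.pr₁ c) (ψ₁ j)
    choose θ hθ using fun j => (𝒢.LG L).pTstar_surjective (ρ.hgz.pr₂ c) (ψ₂ j)
    choose κ hκ using fun j => (𝒢.LG L).pTstar_surjective (ρ.hgz.mul c) (χ j)
    obtain rfl : (fun i => (𝒢.LP L).pT c (ξ i)) = B := funext hξ
    obtain rfl : (fun j => (𝒢.LG L).pTstar (ρ.hgz.pr₁ c) (η j)) = ψ₁ := funext hη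
    obtain rfl : (fun j => (𝒢.LG L).pTstar (ρ.hgz.pr₂ c) (θ j)) = ψ₂ := funext hθ
    obtain rfl : (fun j => (𝒢.LG L).pTstar (ρ.hgz.mul c) (κ j)) = χ := funext hκ
    exact (ρ.hgz_mul_iff T c ξ η θ κ).2 (h c ξ η θ κ
      (fun j => (ρ.jetComposable_pTstar_iff c (η j) (θ j)).1 (hc j))
      (fun j => (ρ.jetMul_pTstar_iff c (η j) (θ j) (κ j)).1 (hm j)))

end LineAction

end

end LieGroupoid

theorem mainTheorem9
    {EM : Type*} [NormedAddCommGroup EM] [NormedSpace ℝ EM] [FiniteDimensional ℝ EM]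
    {M : Type*} [TopologicalSpace M] [ChartedSpace EM M] [IsManifold 𝓘(ℝ, EM) ∞ M] [T2Space M]
    {EG : Type*} [NormedAddCommGroup EG] [NormedSpace ℝ EG] [FiniteDimensional ℝ EG]
    {G : Type*} [TopologicalSpace G] [ChartedSpace EG G] [IsManifold 𝓘(ℝ, EG) ∞ G] [T2Space G]
    {EP : Type*} [NormedAddCommGroup EP] [NormedSpace ℝ EP] [FiniteDimensional ℝ EP]
    {P : Type*} [TopologicalSpace P] [ChartedSpace EP P] [IsManifold 𝓘(ℝ, EP) ∞ P]
    (𝒢 : LieGroupoid 𝓘(ℝ, EM) M 𝓘(ℝ, EG) G 𝓘(ℝ, EP) P)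
    (L : LineBundle 𝓘(ℝ, EM) M) (ρ : 𝒢.LineAction L)
    (l m : ℕ) (T : (𝒢.LG L).AtiyahTensor l m) :
    ρ.IsMultiplicative T ↔
      ρ.hgz.IsMultiplicativeTensor (𝓘(ℝ, EM).prod 𝓘(ℝ, ℝ →L[ℝ] ℝ))
        (𝓘(ℝ, EG).prod 𝓘(ℝ, ℝ →L[ℝ] ℝ)) (𝓘(ℝ, EP).prod 𝓘(ℝ, ℝ →L[ℝ] ℝ)) T.hgz :=
  ρ.isMultiplicative_iff_hgz T
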